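/- Call a simple graph with $n$ vertices a Laman graph if it has exactly $2n-3$ edges and, for every $k\ge 2$, every set of $k$ of its vertices spans at most $2k-3$ edges. Let $G$ be a simple graph with $n$ vertices and $2n-3$ edges. If a partition of the edge set of $G$ into two forests is given, then it can be decided in $O(n\log n)$ time whether $G$ is a Laman graph. That is, there is a single program for a random access machine with words of $O(\log n)$ bits (unit-cost addition, subtraction, comparison of words and indirect memory access) that, for every such $G$ on the vertex set $\{0,\dots,n-1\}$ and every partition of its edge set into two forests, given $n$ and the edge lists of the two forests (edges and endpoints in any order), halts after $O(n\log n)$ steps with the correct answer. -/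

import Mathlib

/-- A finite simple graph `G` is a *Laman graph* if it has exactly `2 |V| - 3` edges and every set
of `k ≥ 2` vertices spans at most `2 k - 3` edges of `G`. -/
def IsLaman {V : Type*} [Fintype V] (G : SimpleGraph V) : Prop :=
  G.edgeSet.ncard + 3 = 2 * Fintype.card V ∧
    ∀ S : Finset V, 2 ≤ S.card →
      {e : Sym2 V | e ∈ G.edgeSet ∧ ∀ v ∈ e, v ∈ S}.ncard + 3 ≤ 2 * S.card

/-- `F₁`, `F₂` is a partition of (the edge set of) `G` into two forests. -/
structure IsForestPartition {V : Type*} (G F₁ F₂ : SimpleGraph V) : Prop where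
  union : F₁ ⊔ F₂ = G
  disjoint : Disjoint F₁ F₂
  left_acyclic : F₁.IsAcyclic
  right_acyclic : F₂.IsAcyclic

/-- `L` lists every edge of `F` exactly once, in some order, each edge being written as a pair of
its endpoints in one of the two possible orders. -/
def IsEdgeList {n : ℕ} (F : SimpleGraph (Fin n)) (L : List (Fin n × Fin n)) : Prop :=
  (L.map fun p => s(p.1, p.2)).Nodup ∧
    ∀ e : Sym2 (Fin n), e ∈ (L.map fun p => s(p.1, p.2)) ↔ e ∈ F.edgeSet

/-- The endpoints of the edges in the list, one after the other, as numbers. -/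
def endpoints {n : ℕ} (L : List (Fin n × Fin n)) : List ℕ :=
  L.flatMap fun p => [(p.1 : ℕ), (p.2 : ℕ)]

/-- The input sequence of words: the number of vertices, the lengths of the two edge lists, and then
the endpoints of the edges in the first list and in the second list. -/
def inputWords {n : ℕ} (L₁ L₂ : List (Fin n × Fin n)) : List ℕ :=
  [n, L₁.length, L₂.length] ++ endpoints L₁ ++ endpoints L₂

namespace WordRAM

/-- A state of the random access machine: registers and memory cells, each holding a number.
A program mentions finitely many registers; all memory cells are reachable by indirect addressing. -/
structure State where
  reg : ℕ → ℕ
  mem : ℕ → ℕ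

/-- Initially the memory contains the input words in the cells `0, 1, 2, …` and everything
else is `0`. -/
def initial (input : List ℕ) : State where
  reg := fun _ => 0
  mem := fun i => input.getD i 0

/-- The basic instructions. `d`, `a`, `b` are names of registers, `k` is a numerical constant. -/
inductive Instr
  | const (d k : ℕ)
  | copy (d a : ℕ)
  | add (d a b : ℕ)
  | sub (d a b : ℕ)
  | load (d a : ℕ)
  | store (a b : ℕ)

/-- Write the value `v` to register `d`. -/
def State.setReg (s : State) (d v : ℕ) : State :=
  { s with reg := Function.update s.reg d v }

/-- Write the value `v` to memory cell `i`. -/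
def State.setMem (s : State) (i v : ℕ) : State :=
  { s with mem := Function.update s.mem i v }

/-- The effect of a basic instruction on a machine with words of `w` bits. Constants and sums are
reduced modulo `2 ^ w`; subtraction is truncated at `0`. `load d a` reads the memory cell whose
address is in register `a` into register `d`; `store a b` writes the content of register `b` to the
memory cell whose address is in register `a`. -/
def Instr.exec (w : ℕ) : Instr → State → State
  | .const d k, s => s.setReg d (k % 2 ^ w)
  | .copy d a, s => s.setReg d (s.reg a)
  | .add d a b, s => s.setReg d ((s.reg a + s.reg b) % 2 ^ w)
  | .sub d a b, s => s.setReg d (s.reg a - s.reg b)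
  | .load d a, s => s.setReg d (s.mem (s.reg a))
  | .store a b, s => s.setMem (s.reg a) (s.reg b)

/-- The tests on which a program can branch: comparisons of two registers. -/
inductive Test
  | lt (a b : ℕ)
  | eq (a b : ℕ)

/-- The truth value of a test in a state. -/
def Test.holds : Test → State → Prop
  | .lt a b, s => s.reg a < s.reg b
  | .eq a b, s => s.reg a = s.reg b

/-- Programs: basic instructions combined by sequencing, branching and while loops. -/
inductive Prog
  | skip
  | instr (i : Instr)
  | seq (p q : Prog)
  | ite (b : Test) (p q : Prog)
  | loop (b : Test) (p : Prog)

/-- `Exec w p s s' t`: on a machine with words of `w` bits, the program `p` started in the state `s`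
halts in the state `s'` after exactly `t` steps. Every execution of a basic instruction
and every evaluation of a test is one step. -/
inductive Exec (w : ℕ) : Prog → State → State → ℕ → Prop
  | skip (s : State) : Exec w .skip s s 1
  | instr (i : Instr) (s : State) : Exec w (.instr i) s (i.exec w s) 1
  | seq {p q : Prog} {s s₁ s₂ : State} {t₁ t₂ : ℕ} :
      Exec w p s s₁ t₁ → Exec w q s₁ s₂ t₂ → Exec w (.seq p q) s s₂ (t₁ + t₂)
  | ite_true {b : Test} {p q : Prog} {s s₁ : State} {t : ℕ} :
      b.holds s → Exec w p s s₁ t → Exec w (.ite b p q) s s₁ (t + 1)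
  | ite_false {b : Test} {p q : Prog} {s s₁ : State} {t : ℕ} :
      ¬ b.holds s → Exec w q s s₁ t → Exec w (.ite b p q) s s₁ (t + 1)
  | loop_false {b : Test} {p : Prog} {s : State} :
      ¬ b.holds s → Exec w (.loop b p) s s 1
  | loop_true {b : Test} {p : Prog} {s s₁ s₂ : State} {t₁ t₂ : ℕ} :
      b.holds s → Exec w p s s₁ t₁ → Exec w (.loop b p) s₁ s₂ t₂ →
        Exec w (.loop b p) s s₂ (t₁ + t₂ + 1)

end WordRAM

/-!
The edges of a forest on `k` vertices number at most `k - 1`. A set of `k` vertices therefore spans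
more than `2 k - 3` edges of the union of two disjoint forests exactly if both forests are connected
on it (`isLaman_iff`). The program searches for such a set by deleting edges that cannot belong
to one.

The two forests are placed on two copies of the vertex set and form a single forest on `2 n` nodes
(`Net`). A set of edges is called supported if for each of its edges the other copies of the two
endpoints are connected by edges of the set. The edges spanned by a set on which both forests are
connected form a supported set, and the vertices of a component of a nonempty supported set are such
a set (`Code.supported_iff`). So the graph is a Laman graph if and only if only the empty set is
supported.

The greatest supported set is found by deletion: an edge whose endpoints have separated other copies
is put into a queue, and the edges in the queue are deleted one after the other. The deletion of an
edge splits its tree in two parts. The pairs of nodes separated by this are those with exactly one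
node in the lighter part, so it suffices to scan the edges at the other copies of the nodes of the
lighter part (`splitCmd_wp`). In the beginning, one forest is a tree and the other one consists of
two trees, and the separated pairs are found by the same procedure, applied to the two
copies of the vertex `0` (`Code.start`). When the queue is empty, the remaining edges form the
greatest supported set (`pruneCmd_wp`).

The lighter part is found by searching both parts in parallel, at a cost proportional to its weight,
where the weight of a node is its degree plus one. Each time a node belongs to the lighter part, the
weight of its component is at least halved. Hence the potential `Net.pot`, the sum of
`charge x * log (weight of the component of x)`, pays for all splits (`Net.pot_delete`), and it is
`O(n log n)` (`Net.pot_le`).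

The program is written in a small language with named variables and arrays (`Cmd`), whose arrays are
interpreted in the memory of the word RAM (`Rep`). Its specifications are weakest preconditions
(`Cmd.wp`) that bound the number of machine steps. Programs without loops are verified by evaluating
a verification condition (`Cmd.wp_of_vc`), and loops by invariants (`Cmd.wp_loop`).
-/

/-! ### A small imperative language with arrays, compiled to the word RAM -/

namespace LamanRAM

/-- The variables of the program. `out` is the answer. The names that end in `A` and `B` belong to
the two searches that run in parallel; `popped` and `pushed` delimit the queue of edges; `stamp` is
the largest mark in use. -/
inductive Var
  | out
  | pos | node | nbr | twin | ptr | dart | edge | tmp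
  | endA | endB | stamp
  | stampA | startA | headA | tailA | ptrA
  | stampB | startB | headB | tailB | ptrB
  | done | popped | pushed
  deriving DecidableEq

/-- The arrays of the program. `dst`, `eid` and `next` give the head and the edge of a dart
and the next dart in an adjacency list; `head` gives the first dart at a node and `mark` its last
visit; `queue` holds the nodes visited by the searches; `status` is `0`, `1` or `2` for an edge that
is fresh, queued or deleted, and `del` is the queue of edges. -/
inductive Arr
  | input | dst | eid | next | head | status | mark | queue | del
  deriving DecidableEq

/-- The constants of the program: values which are computed once and never change. -/
inductive Con
  | zero | one | two | verts | nodes | firstLen | edges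

/-- An operand is a variable or a constant. -/
inductive Opd
  | var (x : Var)
  | con (c : Con)

instance : Coe Var Opd := ⟨.var⟩
instance : Coe Con Opd := ⟨.con⟩

/-- Tests: comparison of two operands. -/
inductive Cond
  | lt (a b : Opd)
  | eq (a b : Opd)

/-- Programs with named variables and arrays. -/
inductive Cmd
  | set (d : Var) (a : Opd)
  | add (d : Var) (a b : Opd)
  | sub (d : Var) (a b : Opd)
  | rd (d : Var) (j : Arr) (i : Opd)
  | wr (j : Arr) (i a : Opd)
  | skip
  | seq (p q : Cmd)
  | ite (b : Cond) (p q : Cmd)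
  | loop (b : Cond) (p : Cmd)

/-- A configuration: the values of all variables and the contents of all arrays. -/
@[ext] structure Cfg where
  v : Var → ℕ
  a : Arr → ℕ → ℕ

/-- The data that stay fixed during a run: the values of the constants, the length of every array,
and the number of bits of a word. The nine arrays lie one after the other in the memory, and all
addresses fit into a word. -/
structure Ctx where
  con : Con → ℕ
  len : ℕ
  w : ℕ
  fits : 9 * len ≤ 2 ^ w

namespace Cfg

/-- Assign the value `k` to the variable `x`. -/
def setV (σ : Cfg) (x : Var) (k : ℕ) : Cfg := { σ with v := Function.update σ.v x k }

/-- Write the value `k` to the cell `i` of the array `j`. -/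
def setA (σ : Cfg) (j : Arr) (i k : ℕ) : Cfg :=
  { σ with a := Function.update σ.a j (Function.update (σ.a j) i k) }

@[simp] theorem setV_v (σ : Cfg) (x y : Var) (k : ℕ) :
    (σ.setV x k).v y = if y = x then k else σ.v y := by
  simp [setV, Function.update_apply]

@[simp] theorem setV_a (σ : Cfg) (x : Var) (k : ℕ) : (σ.setV x k).a = σ.a := rfl

@[simp] theorem setA_v (σ : Cfg) (j : Arr) (i k : ℕ) : (σ.setA j i k).v = σ.v := rfl

@[simp] theorem setA_a (σ : Cfg) (j j' : Arr) (i k : ℕ) :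
    (σ.setA j i k).a j' = if j' = j then Function.update (σ.a j) i k else σ.a j' := by
  simp [setA, Function.update_apply]

end Cfg

/-- The value of an operand. -/
def Opd.val (C : Ctx) (σ : Cfg) : Opd → ℕ
  | .var x => σ.v x
  | .con c => C.con c

@[simp] theorem Opd.val_var (C : Ctx) (σ : Cfg) (x : Var) : (Opd.var x).val C σ = σ.v x := rfl

@[simp] theorem Opd.val_con (C : Ctx) (σ : Cfg) (c : Con) : (Opd.con c).val C σ = C.con c := rfl

/-- The truth value of a test. -/
def Cond.holds (C : Ctx) (σ : Cfg) : Cond → Prop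
  | .lt a b => a.val C σ < b.val C σ
  | .eq a b => a.val C σ = b.val C σ

@[simp] theorem Cond.holds_lt (C : Ctx) (σ : Cfg) (a b : Opd) :
    (Cond.lt a b).holds C σ ↔ a.val C σ < b.val C σ := Iff.rfl

@[simp] theorem Cond.holds_eq (C : Ctx) (σ : Cfg) (a b : Opd) :
    (Cond.eq a b).holds C σ ↔ a.val C σ = b.val C σ := Iff.rfl

/-- The register of a variable; `Var.out` lives in register `0`. Registers of variables, constants
and arrays are distinguished by their residues modulo `4`. -/
def Var.reg (x : Var) : ℕ := 4 * x.ctorIdx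

/-- The register that holds a constant. -/
def Con.reg (c : Con) : ℕ := 4 * c.ctorIdx + 1

/-- The register that holds the address of the first cell of an array. -/
def Arr.reg (j : Arr) : ℕ := 4 * j.ctorIdx + 2

/-- The register in which addresses are computed. -/
def addrReg : ℕ := 3

/-- The register of an operand. -/
def Opd.reg : Opd → ℕ
  | .var x => x.reg
  | .con c => c.reg

theorem Var.reg_injective : Function.Injective Var.reg := by
  intro x y h
  have : x.ctorIdx = y.ctorIdx := by unfold Var.reg at h; omega
  cases x <;> cases y <;> first | rfl | (exact absurd this (by decide))

theorem Arr.ctorIdx_injective : Function.Injective Arr.ctorIdx := by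
  intro x y h
  cases x <;> cases y <;> first | rfl | (exact absurd h (by decide))

theorem Arr.ctorIdx_lt (j : Arr) : j.ctorIdx < 9 := by
  cases j <;> decide

open WordRAM

/-- Translation of tests. -/
def Cond.compile : Cond → Test
  | .lt a b => .lt a.reg b.reg
  | .eq a b => .eq a.reg b.reg

/-- Translation of programs into programs of the word RAM. -/
def Cmd.compile : Cmd → Prog
  | .set d a => .instr (.copy d.reg a.reg)
  | .add d a b => .instr (.add d.reg a.reg b.reg)
  | .sub d a b => .instr (.sub d.reg a.reg b.reg)
  | .rd d j i => .seq (.instr (.add addrReg j.reg i.reg)) (.instr (.load d.reg addrReg))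
  | .wr j i a => .seq (.instr (.add addrReg j.reg i.reg)) (.instr (.store addrReg a.reg))
  | .skip => .skip
  | .seq p q => .seq p.compile q.compile
  | .ite b p q => .ite b.compile p.compile q.compile
  | .loop b p => .loop b.compile p.compile

/-- The state `s` of the machine represents the configuration `σ`. -/
structure Rep (C : Ctx) (s : State) (σ : Cfg) : Prop where
  var : ∀ x : Var, s.reg x.reg = σ.v x
  con : ∀ c : Con, s.reg c.reg = C.con c
  base : ∀ j : Arr, s.reg j.reg = j.ctorIdx * C.len
  arr : ∀ (j : Arr) (i : ℕ), i < C.len → s.mem (j.ctorIdx * C.len + i) = σ.a j i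

/-- Weakest precondition: from every state that represents `σ`, the program halts, and the final
configuration and the number of steps satisfy `Post`. -/
def Cmd.wp (C : Ctx) (c : Cmd) (Post : Cfg → ℕ → Prop) (σ : Cfg) : Prop :=
  ∀ s, Rep C s σ → ∃ s' t σ', Exec C.w c.compile s s' t ∧ Rep C s' σ' ∧ Post σ' t

/-- A verification condition for programs without loops: the final configuration satisfies `Q`,
no addition overflows, and all array indices are in range. Sums are required to be at most `C.len`,
which is more than enough for them to fit into a word. It is `False` for loops. -/
def Cmd.vc (C : Ctx) : Cmd → (Cfg → Prop) → Cfg → Prop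
  | .set d a, Q, σ => Q (σ.setV d (a.val C σ))
  | .add d a b, Q, σ =>
      a.val C σ + b.val C σ ≤ C.len ∧ Q (σ.setV d (a.val C σ + b.val C σ))
  | .sub d a b, Q, σ => Q (σ.setV d (a.val C σ - b.val C σ))
  | .rd d j i, Q, σ => i.val C σ < C.len ∧ Q (σ.setV d (σ.a j (i.val C σ)))
  | .wr j i a, Q, σ => i.val C σ < C.len ∧ Q (σ.setA j (i.val C σ) (a.val C σ))
  | .skip, Q, σ => Q σ
  | .seq p q, Q, σ => p.vc C (q.vc C Q) σ
  | .ite b p q, Q, σ => (b.holds C σ → p.vc C Q σ) ∧ (¬ b.holds C σ → q.vc C Q σ)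
  | .loop _ _, _, _ => False

/-- An upper bound for the number of steps of a program without loops; the value for a loop has no
meaning. -/
def Cmd.cost : Cmd → ℕ
  | .set _ _ => 1
  | .add _ _ _ => 1
  | .sub _ _ _ => 1
  | .rd _ _ _ => 2
  | .wr _ _ _ => 2
  | .skip => 1
  | .seq p q => p.cost + q.cost
  | .ite _ p q => max p.cost q.cost + 1
  | .loop _ _ => 0

theorem _root_.WordRAM.State.setReg_reg_of_ne (s : State) {d r : ℕ} (k : ℕ) (h : r ≠ d) :
    (s.setReg d k).reg r = s.reg r := Function.update_of_ne h _ _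

theorem Rep.opd {C : Ctx} {s : State} {σ : Cfg} (h : Rep C s σ) (a : Opd) :
    s.reg a.reg = a.val C σ := by
  cases a with
  | var x => exact h.var x
  | con c => exact h.con c

theorem Rep.holds_iff {C : Ctx} {s : State} {σ : Cfg} (h : Rep C s σ) (b : Cond) :
    b.compile.holds s ↔ b.holds C σ := by
  cases b <;> simp [Cond.compile, Test.holds, h.opd]

theorem Rep.setV {C : Ctx} {s : State} {σ : Cfg} (h : Rep C s σ) (x : Var) (k : ℕ) :
    Rep C (s.setReg x.reg k) (σ.setV x k) where
  var y := by
    by_cases hy : y = x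
    · simp [State.setReg, hy]
    · simp [State.setReg, hy, Function.update_of_ne (Var.reg_injective.ne hy), h.var]
  con c := by
    have : c.reg ≠ x.reg := by simp only [Con.reg, Var.reg]; omega
    rw [State.setReg_reg_of_ne _ _ this, h.con]
  base j := by
    have : j.reg ≠ x.reg := by simp only [Arr.reg, Var.reg]; omega
    rw [State.setReg_reg_of_ne _ _ this, h.base]
  arr := h.arr

theorem Rep.setAddr {C : Ctx} {s : State} {σ : Cfg} (h : Rep C s σ) (k : ℕ) :
    Rep C (s.setReg addrReg k) σ where
  var y := by
    have : y.reg ≠ addrReg := by simp only [addrReg, Var.reg]; omega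
    rw [State.setReg_reg_of_ne _ _ this, h.var]
  con c := by
    have : c.reg ≠ addrReg := by simp only [Con.reg, addrReg]; omega
    rw [State.setReg_reg_of_ne _ _ this, h.con]
  base j := by
    have : j.reg ≠ addrReg := by simp only [Arr.reg, addrReg]; omega
    rw [State.setReg_reg_of_ne _ _ this, h.base]
  arr := h.arr

/-- Cells of different arrays have different addresses. -/
theorem address_inj {L i i' j j' : ℕ} (hi : i < L) (hi' : i' < L)
    (h : j * L + i = j' * L + i') : j = j' ∧ i = i' := by
  have hj : j = j' := by
    rcases lt_trichotomy j j' with hlt | rfl | hlt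
    · nlinarith
    · rfl
    · nlinarith
  subst hj
  omega

theorem Rep.setA {C : Ctx} {s : State} {σ : Cfg} (h : Rep C s σ) (j : Arr) (i k : ℕ)
    (hi : i < C.len) : Rep C (s.setMem (j.ctorIdx * C.len + i) k) (σ.setA j i k) where
  var := h.var
  con := h.con
  base := h.base
  arr j' i' hi' := by
    by_cases hj : j' = j
    · subst hj
      by_cases hii : i' = i
      · simp [State.setMem, hii]
      · have : j'.ctorIdx * C.len + i' ≠ j'.ctorIdx * C.len + i := by omega
        simp [State.setMem, hii, h.arr j' i' hi']
    · have : j'.ctorIdx * C.len + i' ≠ j.ctorIdx * C.len + i := fun hh =>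
        hj (Arr.ctorIdx_injective (address_inj hi' hi hh).1)
      simp [State.setMem, Function.update_of_ne this, hj, h.arr j' i' hi']

theorem Ctx.address_lt (C : Ctx) (j : Arr) {i : ℕ} (hi : i < C.len) :
    j.ctorIdx * C.len + i < 2 ^ C.w := by
  have h1 := C.fits
  have h2 := j.ctorIdx_lt
  nlinarith

theorem Rep.exec_addr {C : Ctx} {s : State} {σ : Cfg} (h : Rep C s σ) (j : Arr) (i : Opd)
    (hi : i.val C σ < C.len) :
    (Instr.add addrReg j.reg i.reg).exec C.w s =
      s.setReg addrReg (j.ctorIdx * C.len + i.val C σ) := by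
  simp [Instr.exec, h.base, h.opd, Nat.mod_eq_of_lt (C.address_lt j hi)]

theorem Cmd.wp_mono {C : Ctx} {c : Cmd} {P Q : Cfg → ℕ → Prop} {σ : Cfg} (h : c.wp C P σ)
    (hPQ : ∀ σ' t, P σ' t → Q σ' t) : c.wp C Q σ := by
  intro s hs
  obtain ⟨s', t, σ', h1, h2, h3⟩ := h s hs
  exact ⟨s', t, σ', h1, h2, hPQ _ _ h3⟩

theorem Cmd.wp_seq {C : Ctx} {p q : Cmd} {P : Cfg → ℕ → Prop} {σ : Cfg}
    (h : p.wp C (fun σ₁ t₁ => q.wp C (fun σ₂ t₂ => P σ₂ (t₁ + t₂)) σ₁) σ) :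
    (Cmd.seq p q).wp C P σ := by
  intro s hs
  obtain ⟨s₁, t₁, σ₁, h1, h2, h3⟩ := h s hs
  obtain ⟨s₂, t₂, σ₂, h4, h5, h6⟩ := h3 s₁ h2
  exact ⟨s₂, t₁ + t₂, σ₂, .seq h1 h4, h5, h6⟩

/-- The verification condition of a loop-free program is sufficient. -/
theorem Cmd.wp_of_vc {C : Ctx} {c : Cmd} {Q : Cfg → Prop} {σ : Cfg} (h : c.vc C Q σ) :
    c.wp C (fun σ' t => t ≤ c.cost ∧ Q σ') σ := by
  induction c generalizing Q σ with
  | set d a =>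
    intro s hs
    refine ⟨_, _, _, .instr _ _, ?_, le_rfl, h⟩
    simpa [Instr.exec, hs.opd] using hs.setV d (a.val C σ)
  | add d a b =>
    intro s hs
    refine ⟨_, _, _, .instr _ _, ?_, le_rfl, h.2⟩
    have hlt : a.val C σ + b.val C σ < 2 ^ C.w := by
      have h1 := h.1
      have h2 := C.fits
      have h3 := Nat.two_pow_pos C.w
      omega
    simpa [Instr.exec, hs.opd, Nat.mod_eq_of_lt hlt] using hs.setV d (a.val C σ + b.val C σ)
  | sub d a b =>
    intro s hs
    refine ⟨_, _, _, .instr _ _, ?_, le_rfl, h⟩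
    simpa [Instr.exec, hs.opd] using hs.setV d (a.val C σ - b.val C σ)
  | rd d j i =>
    intro s hs
    refine ⟨_, _, _, .seq (.instr _ _) (.instr _ _), ?_, le_rfl, h.2⟩
    rw [hs.exec_addr j i h.1]
    have := (hs.setAddr (j.ctorIdx * C.len + i.val C σ)).setV d (σ.a j (i.val C σ))
    rw [← hs.arr j _ h.1] at this ⊢
    simpa [Instr.exec, State.setReg] using this
  | wr j i a =>
    intro s hs
    refine ⟨_, _, _, .seq (.instr _ _) (.instr _ _), ?_, le_rfl, h.2⟩
    rw [hs.exec_addr j i h.1]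
    have hs' := hs.setAddr (j.ctorIdx * C.len + i.val C σ)
    have := hs'.setA j (i.val C σ) (a.val C σ) h.1
    rw [← hs'.opd a] at this ⊢
    simpa [Instr.exec, State.setReg] using this
  | skip =>
    intro s hs
    exact ⟨_, _, _, .skip s, hs, le_rfl, h⟩
  | seq p q ihp ihq =>
    refine Cmd.wp_seq (Cmd.wp_mono (ihp h) ?_)
    rintro σ₁ t₁ ⟨ht₁, h₁⟩
    refine Cmd.wp_mono (ihq h₁) ?_
    rintro σ₂ t₂ ⟨ht₂, h₂⟩
    exact ⟨Nat.add_le_add ht₁ ht₂, h₂⟩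
  | ite b p q ihp ihq =>
    intro s hs
    by_cases hb : b.holds C σ
    · obtain ⟨s', t, σ', h1, h2, h3, h4⟩ := ihp (h.1 hb) s hs
      exact ⟨s', t + 1, σ', .ite_true ((hs.holds_iff b).2 hb) h1, h2,
        Nat.succ_le_succ (le_trans h3 (le_max_left _ _)), h4⟩
    · obtain ⟨s', t, σ', h1, h2, h3, h4⟩ := ihq (h.2 hb) s hs
      exact ⟨s', t + 1, σ', .ite_false (fun hh => hb ((hs.holds_iff b).1 hh)) h1, h2,
        Nat.succ_le_succ (le_trans h3 (le_max_right _ _)), h4⟩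
  | loop b p _ => exact h.elim

/-- The rule for loops: `I σ φ` says that the invariant holds in `σ` and that at most `φ` steps are
left. -/
theorem Cmd.wp_loop {C : Ctx} {b : Cond} {p : Cmd} (I : Cfg → ℕ → Prop)
    (hI : ∀ σ φ, I σ φ → b.holds C σ → p.wp C (fun σ' t => ∃ φ', I σ' φ' ∧ t + φ' + 1 ≤ φ) σ)
    {σ : Cfg} {φ : ℕ} (h : I σ φ) :
    (Cmd.loop b p).wp C (fun σ' t => ¬ b.holds C σ' ∧ ∃ φ', I σ' φ' ∧ t + φ' ≤ φ + 1) σ := by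
  induction φ using Nat.strong_induction_on generalizing σ with
  | _ φ ih =>
    intro s hs
    by_cases hb : b.holds C σ
    · obtain ⟨s₁, t₁, σ₁, h1, h2, φ', h3, h4⟩ := hI σ φ h hb s hs
      obtain ⟨s₂, t₂, σ₂, h5, h6, h7, φ'', h8, h9⟩ := ih φ' (by omega) h3 s₁ h2
      exact ⟨s₂, t₁ + t₂ + 1, σ₂, .loop_true ((hs.holds_iff b).2 hb) h1 h5, h6, h7, φ'', h8,
        by omega⟩
    · exact ⟨s, 1, σ, .loop_false (fun hh => hb ((hs.holds_iff b).1 hh)), hs, hb, φ, h,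
        by omega⟩

end LamanRAM

/-! ### Forests given by an edge list, and deletion of edges -/

namespace LamanRAM

/-- The graph on the natural numbers whose edges are the pairs `X e`, `Y e` with `e < m` and
`P e`. -/
def edgeGraph (m : ℕ) (X Y : ℕ → ℕ) (P : ℕ → Prop) : SimpleGraph ℕ where
  Adj x y := x ≠ y ∧ ∃ e < m, P e ∧ (X e = x ∧ Y e = y ∨ X e = y ∧ Y e = x)
  symm := ⟨fun x y h => ⟨h.1.symm, by
    obtain ⟨e, he, hP, h⟩ := h.2
    exact ⟨e, he, hP, h.symm⟩⟩⟩
  loopless := ⟨fun x h => h.1 rfl⟩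

/-- A forest on the nodes `0, …, 2 n - 1` with `2 n - 3` edges, the `e`-th one with the endpoints
`X e` and `Y e`. The nodes `v` and `v + n` are the two copies of the vertex `v`, one for each of the
two given forests. Acyclicity is expressed by saying that every edge is a bridge. -/
structure Net where
  n : ℕ
  m : ℕ
  X : ℕ → ℕ
  Y : ℕ → ℕ
  two_le : 2 ≤ n
  card : m + 3 = 2 * n
  X_lt : ∀ e < m, X e < 2 * n
  Y_lt : ∀ e < m, Y e < 2 * n
  bridge : ∀ e < m, ¬ (edgeGraph m X Y (· ≠ e)).Reachable (X e) (Y e)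

namespace Net

variable (N : Net)

/-- The subgraph of those edges that satisfy `P`. -/
def gr (P : ℕ → Prop) : SimpleGraph ℕ := edgeGraph N.m N.X N.Y P

/-- The other copy of a node. -/
def tw (x : ℕ) : ℕ := if x < N.n then x + N.n else x - N.n

/-- A set `Z` of edges is supported if for every edge in `Z` the other copies of its endpoints are
connected by edges in `Z`. -/
def Supported (Z : Set ℕ) : Prop :=
  ∀ e ∈ Z, e < N.m ∧ (N.gr (· ∈ Z)).Reachable (N.tw (N.X e)) (N.tw (N.Y e))

variable {N}

theorem tw_lt {x : ℕ} (hx : x < 2 * N.n) : N.tw x < 2 * N.n := by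
  unfold tw; split <;> omega

theorem tw_tw {x : ℕ} (hx : x < 2 * N.n) : N.tw (N.tw x) = x := by
  unfold tw; split <;> split <;> omega

theorem gr_mono {P Q : ℕ → Prop} (h : ∀ e < N.m, P e → Q e) : N.gr P ≤ N.gr Q := by
  rintro x y ⟨hxy, e, he, hP, h'⟩
  exact ⟨hxy, e, he, h e he hP, h'⟩

theorem gr_congr {P Q : ℕ → Prop} (h : ∀ e < N.m, P e ↔ Q e) : N.gr P = N.gr Q :=
  le_antisymm (gr_mono fun e he => (h e he).1) (gr_mono fun e he => (h e he).2)

theorem not_reachable_of_not {P : ℕ → Prop} {e : ℕ} (he : e < N.m) (hP : ¬ P e) :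
    ¬ (N.gr P).Reachable (N.X e) (N.Y e) := fun h =>
  N.bridge e he (h.mono (gr_mono fun f _ hf => by rintro rfl; exact hP hf))

theorem X_ne_Y {e : ℕ} (he : e < N.m) : N.X e ≠ N.Y e := fun h =>
  N.bridge e he (h ▸ SimpleGraph.Reachable.refl _)

theorem gr_adj {P : ℕ → Prop} {e : ℕ} (he : e < N.m) (hP : P e) :
    (N.gr P).Adj (N.X e) (N.Y e) :=
  ⟨X_ne_Y he, e, he, hP, .inl ⟨rfl, rfl⟩⟩

/-- A path that uses the edge `e` splits at `e`. -/
theorem reachable_delete {P P' : ℕ → Prop} {e : ℕ} (hP' : ∀ f, P f → f ≠ e → P' f) {a b : ℕ}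
    (h : (N.gr P).Reachable a b) :
    (N.gr P').Reachable a b ∨
      ((N.gr P').Reachable a (N.X e) ∧ (N.gr P').Reachable (N.Y e) b) ∨
      ((N.gr P').Reachable a (N.Y e) ∧ (N.gr P').Reachable (N.X e) b) := by
  rw [SimpleGraph.reachable_iff_reflTransGen] at h
  induction h with
  | refl => exact .inl (.refl _)
  | @tail b c _ hbc ih =>
    obtain ⟨hne, f, hf, hPf, hbc'⟩ := hbc
    by_cases hfe : f = e
    · subst hfe
      rcases hbc' with ⟨rfl, rfl⟩ | ⟨rfl, rfl⟩
      · rcases ih with ih | ⟨ih, _⟩ | ⟨ih, _⟩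
        · exact .inr (.inl ⟨ih, .refl _⟩)
        · exact .inr (.inl ⟨ih, .refl _⟩)
        · exact .inl ih
      · rcases ih with ih | ⟨ih, _⟩ | ⟨ih, _⟩
        · exact .inr (.inr ⟨ih, .refl _⟩)
        · exact .inl ih
        · exact .inr (.inr ⟨ih, .refl _⟩)
    · have hadj : (N.gr P').Reachable b c :=
        SimpleGraph.Adj.reachable ⟨hne, f, hf, hP' f hPf hfe, hbc'⟩
      rcases ih with ih | ⟨ih, ih'⟩ | ⟨ih, ih'⟩
      · exact .inl (ih.trans hadj)
      · exact .inr (.inl ⟨ih, ih'.trans hadj⟩)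
      · exact .inr (.inr ⟨ih, ih'.trans hadj⟩)

theorem lt_of_reachable {P : ℕ → Prop} {a b : ℕ} (h : (N.gr P).Reachable a b)
    (ha : a < 2 * N.n) : b < 2 * N.n := by
  rw [SimpleGraph.reachable_iff_reflTransGen] at h
  induction h with
  | refl => exact ha
  | tail _ hbc _ =>
    obtain ⟨_, f, hf, _, ⟨_, rfl⟩ | ⟨rfl, _⟩⟩ := hbc
    · exact N.Y_lt f hf
    · exact N.X_lt f hf

variable (N)

/-- Every edge `e` consists of two darts `2 e` and `2 e + 1`; this is the tail of a dart. -/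
def src (d : ℕ) : ℕ := if d % 2 = 0 then N.X (d / 2) else N.Y (d / 2)

/-- The head of a dart. -/
def dst (d : ℕ) : ℕ := if d % 2 = 0 then N.Y (d / 2) else N.X (d / 2)

/-- The darts below `k` with tail `x`, in decreasing order. -/
def adjUpTo : ℕ → ℕ → List ℕ
  | 0, _ => []
  | k + 1, x => if N.src k = x then k :: adjUpTo k x else adjUpTo k x

/-- The darts with tail `x`. -/
def adj (x : ℕ) : List ℕ := N.adjUpTo (2 * N.m) x

/-- The weight of a node: the number of steps needed to scan its adjacency list. -/
def wt (x : ℕ) : ℕ := 1 + (N.adj x).length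

open Classical in
/-- The connected component of `x`, as a finite set of nodes. -/
noncomputable def comp (P : ℕ → Prop) (x : ℕ) : Finset ℕ :=
  (Finset.range (2 * N.n)).filter fun y => (N.gr P).Reachable x y

/-- The weight of the connected component of `x`. -/
noncomputable def compWt (P : ℕ → Prop) (x : ℕ) : ℕ := ∑ y ∈ N.comp P x, N.wt y

/-- The work caused by a node when it belongs to the smaller part of a component that is split. -/
def charge (x : ℕ) : ℕ := N.wt x + N.wt (N.tw x)

/-- The potential that pays for all future splits of components. -/
noncomputable def pot (P : ℕ → Prop) : ℕ :=
  ∑ x ∈ Finset.range (2 * N.n), N.charge x * Nat.log 2 (N.compWt P x)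

variable {N}

theorem mem_adjUpTo {k x d : ℕ} : d ∈ N.adjUpTo k x ↔ d < k ∧ N.src d = x := by
  induction k with
  | zero => simp [adjUpTo]
  | succ k ih =>
    unfold adjUpTo
    split
    · rw [List.mem_cons, ih]
      constructor
      · rintro (rfl | h)
        · exact ⟨by omega, by assumption⟩
        · exact ⟨by omega, h.2⟩
      · rintro ⟨h1, h2⟩
        rcases Nat.lt_succ_iff_lt_or_eq.1 h1 with h | h
        · exact .inr ⟨h, h2⟩
        · exact .inl h
    · rw [ih]
      constructor
      · rintro ⟨h1, h2⟩; exact ⟨by omega, h2⟩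
      · rintro ⟨h1, h2⟩
        refine ⟨lt_of_le_of_ne (by omega) ?_, h2⟩
        rintro rfl; contradiction

theorem mem_adj {x d : ℕ} : d ∈ N.adj x ↔ d < 2 * N.m ∧ N.src d = x := mem_adjUpTo

theorem src_lt {d : ℕ} (hd : d < 2 * N.m) : N.src d < 2 * N.n := by
  unfold src; split
  · exact N.X_lt _ (by omega)
  · exact N.Y_lt _ (by omega)

theorem dst_lt {d : ℕ} (hd : d < 2 * N.m) : N.dst d < 2 * N.n := by
  unfold dst; split
  · exact N.Y_lt _ (by omega)
  · exact N.X_lt _ (by omega)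

theorem gr_adj_dart {P : ℕ → Prop} {d : ℕ} (hd : d < 2 * N.m) (hP : P (d / 2)) :
    (N.gr P).Adj (N.src d) (N.dst d) := by
  unfold src dst; split
  · exact gr_adj (by omega) hP
  · exact (gr_adj (by omega) hP).symm

theorem exists_dart {P : ℕ → Prop} {x y : ℕ} (h : (N.gr P).Adj x y) :
    ∃ d < 2 * N.m, P (d / 2) ∧ N.src d = x ∧ N.dst d = y := by
  obtain ⟨_, e, he, hP, ⟨h1, h2⟩ | ⟨h1, h2⟩⟩ := h
  · exact ⟨2 * e, by omega, by simpa using hP, by simpa [src] using h1, by simpa [dst] using h2⟩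
  · have : (2 * e + 1) / 2 = e := by omega
    have h3 : (2 * e + 1) % 2 = 1 := by omega
    exact ⟨2 * e + 1, by omega, by rwa [this], by simpa [src, this, h3] using h2,
      by simpa [dst, this, h3] using h1⟩

theorem mem_comp {P : ℕ → Prop} {x y : ℕ} (hx : x < 2 * N.n) :
    y ∈ N.comp P x ↔ (N.gr P).Reachable x y := by
  simp only [comp, Finset.mem_filter, Finset.mem_range, and_iff_right_iff_imp]
  exact fun h => lt_of_reachable h hx

theorem comp_subset {P : ℕ → Prop} {x : ℕ} : N.comp P x ⊆ Finset.range (2 * N.n) := by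
  classical exact Finset.filter_subset _ _

theorem comp_eq {P : ℕ → Prop} {x y : ℕ} (h : (N.gr P).Reachable x y) :
    N.comp P x = N.comp P y := by
  ext z
  simp only [comp, Finset.mem_filter, Finset.mem_range, and_congr_right_iff]
  exact fun _ => ⟨fun h' => h.symm.trans h', fun h' => h.trans h'⟩

theorem comp_congr {P Q : ℕ → Prop} (h : ∀ e < N.m, P e ↔ Q e) : N.comp P = N.comp Q := by
  funext x
  ext y
  simp only [comp, gr_congr h, Finset.mem_filter]

theorem compWt_congr {P Q : ℕ → Prop} (h : ∀ e < N.m, P e ↔ Q e) :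
    N.compWt P = N.compWt Q := by
  funext x
  rw [compWt, compWt, comp_congr h]

theorem pot_congr {P Q : ℕ → Prop} (h : ∀ e < N.m, P e ↔ Q e) : N.pot P = N.pot Q := by
  rw [pot, pot, compWt_congr h]

theorem compWt_mono {P Q : ℕ → Prop} (h : ∀ e < N.m, P e → Q e) (x : ℕ) :
    N.compWt P x ≤ N.compWt Q x := by
  refine Finset.sum_le_sum_of_subset fun y hy => ?_
  simp only [comp, Finset.mem_filter] at hy ⊢
  exact ⟨hy.1, hy.2.mono (gr_mono h)⟩

theorem compWt_pos {P : ℕ → Prop} {x : ℕ} (hx : x < 2 * N.n) : 0 < N.compWt P x := by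
  refine Finset.sum_pos (fun y _ => by simp [wt]) ⟨x, (mem_comp hx).2 (.refl _)⟩

/-- If an edge is deleted, the potential drops by the charge of the lighter one of the two
parts of its component: the weight of the component of a node in this part is at least halved. -/
theorem pot_delete {P P' : ℕ → Prop} {e r r' : ℕ} (he : e < N.m) (hPe : P e) (hPe' : ¬ P' e)
    (hP' : ∀ f, P' f → P f) (hr : r = N.X e ∧ r' = N.Y e ∨ r = N.Y e ∧ r' = N.X e)
    (hle : N.compWt P' r ≤ N.compWt P' r') :
    N.pot P' + ∑ x ∈ N.comp P' r, N.charge x ≤ N.pot P := by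
  classical
  have hr_lt : r < 2 * N.n := by
    rcases hr with ⟨rfl, _⟩ | ⟨rfl, _⟩
    exacts [N.X_lt e he, N.Y_lt e he]
  have hr'_lt : r' < 2 * N.n := by
    rcases hr with ⟨_, rfl⟩ | ⟨_, rfl⟩
    exacts [N.Y_lt e he, N.X_lt e he]
  have hrr' : (N.gr P).Reachable r r' := by
    rcases hr with ⟨rfl, rfl⟩ | ⟨rfl, rfl⟩
    exacts [(gr_adj he hPe).reachable, (gr_adj he hPe).symm.reachable]
  have hnot : ¬ (N.gr P').Reachable r r' := by
    rcases hr with ⟨rfl, rfl⟩ | ⟨rfl, rfl⟩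
    exacts [not_reachable_of_not he hPe', fun h => not_reachable_of_not he hPe' h.symm]
  have hle' : N.gr P' ≤ N.gr P := gr_mono fun f _ => hP' f
  have hsum : N.compWt P' r + N.compWt P' r' ≤ N.compWt P r := by
    unfold compWt
    rw [← Finset.sum_union]
    · refine Finset.sum_le_sum_of_subset fun y hy => ?_
      rw [mem_comp hr_lt]
      rcases Finset.mem_union.1 hy with hy | hy
      · exact ((mem_comp hr_lt).1 hy).mono hle'
      · exact hrr'.trans (((mem_comp hr'_lt).1 hy).mono hle')
    · rw [Finset.disjoint_left]
      intro y hy hy'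
      exact hnot (((mem_comp hr_lt).1 hy).trans ((mem_comp hr'_lt).1 hy').symm)
  have hsub : N.comp P' r ⊆ Finset.range (2 * N.n) := comp_subset
  have hchg : ∑ x ∈ N.comp P' r, N.charge x =
      ∑ x ∈ Finset.range (2 * N.n), if x ∈ N.comp P' r then N.charge x else 0 := by
    rw [Finset.sum_ite_mem, Finset.inter_eq_right.2 hsub]
  unfold pot
  rw [hchg, ← Finset.sum_add_distrib]
  refine Finset.sum_le_sum fun x hx => ?_
  have hmono : Nat.log 2 (N.compWt P' x) ≤ Nat.log 2 (N.compWt P x) :=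
    Nat.log_mono_right (compWt_mono (fun f _ => hP' f) x)
  split
  · rename_i hxr
    have hreach := (mem_comp hr_lt).1 hxr
    have h1 : N.compWt P' x = N.compWt P' r := by unfold compWt; rw [comp_eq hreach]
    have h2 : N.compWt P x = N.compWt P r := by unfold compWt; rw [comp_eq (hreach.mono hle')]
    have h3 : Nat.log 2 (N.compWt P' x) + 1 ≤ Nat.log 2 (N.compWt P x) := by
      rw [h1, h2, ← Nat.log_mul_base (by norm_num) (compWt_pos hr_lt).ne']
      exact Nat.log_mono_right (by omega)
    calc _ = N.charge x * (Nat.log 2 (N.compWt P' x) + 1) := by ring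
      _ ≤ _ := Nat.mul_le_mul_left _ h3
  · simpa using Nat.mul_le_mul_left _ hmono

theorem sum_adjUpTo_length {k : ℕ} (hk : k ≤ 2 * N.m) :
    ∑ x ∈ Finset.range (2 * N.n), (N.adjUpTo k x).length = k := by
  induction k with
  | zero => simp [adjUpTo]
  | succ k ih =>
    have h : ∀ x, (N.adjUpTo (k + 1) x).length =
        (N.adjUpTo k x).length + if N.src k = x then 1 else 0 := by
      intro x; rw [adjUpTo]; split <;> simp
    simp only [h, Finset.sum_add_distrib, ih (by omega)]
    simp [src_lt (N := N) (d := k) (by omega)]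

theorem sum_wt : ∑ x ∈ Finset.range (2 * N.n), N.wt x = 2 * N.n + 2 * N.m := by
  simp only [wt, Finset.sum_add_distrib, adj, sum_adjUpTo_length le_rfl]
  simp

theorem sum_charge : ∑ x ∈ Finset.range (2 * N.n), N.charge x = 4 * N.n + 4 * N.m := by
  have h : ∑ x ∈ Finset.range (2 * N.n), N.wt (N.tw x) = ∑ x ∈ Finset.range (2 * N.n), N.wt x := by
    refine Finset.sum_bij' (fun x _ => N.tw x) (fun x _ => N.tw x) ?_ ?_ ?_ ?_ ?_
    · exact fun x hx => Finset.mem_range.2 (tw_lt (Finset.mem_range.1 hx))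
    · exact fun x hx => Finset.mem_range.2 (tw_lt (Finset.mem_range.1 hx))
    · exact fun x hx => tw_tw (Finset.mem_range.1 hx)
    · exact fun x hx => tw_tw (Finset.mem_range.1 hx)
    · exact fun x hx => rfl
  simp only [charge, Finset.sum_add_distrib, h, sum_wt]
  ring

theorem pot_le {P : ℕ → Prop} : N.pot P ≤ 48 * (N.n * Nat.log 2 N.n) := by
  have hn := N.two_le
  have hm := N.card
  have h1 : ∀ x, Nat.log 2 (N.compWt P x) ≤ Nat.log 2 N.n + 3 := by
    intro x
    have hle : N.compWt P x ≤ N.n * 2 * 2 * 2 := by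
      have : N.compWt P x ≤ ∑ x ∈ Finset.range (2 * N.n), N.wt x :=
        Finset.sum_le_sum_of_subset comp_subset
      rw [sum_wt] at this
      omega
    refine (Nat.log_mono_right hle).trans_eq ?_
    rw [Nat.log_mul_base, Nat.log_mul_base, Nat.log_mul_base] <;> omega
  have h2 : N.pot P ≤ ∑ x ∈ Finset.range (2 * N.n), N.charge x * (Nat.log 2 N.n + 3) :=
    Finset.sum_le_sum fun x _ => Nat.mul_le_mul_left _ (h1 x)
  rw [← Finset.sum_mul, sum_charge] at h2
  have h3 : 1 ≤ Nat.log 2 N.n := Nat.log_pos (by norm_num) hn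
  have h4 : 4 * N.n + 4 * N.m ≤ 12 * N.n := by omega
  calc N.pot P ≤ (4 * N.n + 4 * N.m) * (Nat.log 2 N.n + 3) := h2
    _ ≤ (12 * N.n) * (4 * Nat.log 2 N.n) := Nat.mul_le_mul h4 (by omega)
    _ = _ := by ring

theorem Supported.reachable {Z : Set ℕ} (hZ : N.Supported Z) {P : ℕ → Prop}
    (hP : ∀ e ∈ Z, P e) {e : ℕ} (he : e ∈ Z) :
    (N.gr P).Reachable (N.tw (N.X e)) (N.tw (N.Y e)) :=
  (hZ e he).2.mono (gr_mono fun f _ hf => hP f hf)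

end Net
end LamanRAM

/-! ### Linked lists and array segments -/

namespace LamanRAM

/-- `Chain next p l`: the linked list that starts at the pointer `p` has the entries `l`. The
pointer to the entry `d` is `d + 1`, and `0` is the null pointer. -/
def Chain (next : ℕ → ℕ) : ℕ → List ℕ → Prop
  | p, [] => p = 0
  | p, d :: l => p = d + 1 ∧ Chain next (next d) l

/-- `Seg q s l`: the array `q` contains the list `l` from position `s` on. -/
def Seg (q : ℕ → ℕ) : ℕ → List ℕ → Prop
  | _, [] => True
  | s, x :: l => q s = x ∧ Seg q (s + 1) l

theorem Chain.eq_nil {next : ℕ → ℕ} {l : List ℕ} (h : Chain next 0 l) : l = [] := by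
  cases l with
  | nil => rfl
  | cons d l => exact absurd h.1 (by omega)

theorem Chain.exists_cons {next : ℕ → ℕ} {p : ℕ} {l : List ℕ} (h : Chain next p l) (hp : p ≠ 0) :
    ∃ l', l = (p - 1) :: l' ∧ Chain next (next (p - 1)) l' := by
  cases l with
  | nil => exact absurd h hp
  | cons d l =>
    obtain ⟨rfl, h⟩ := h
    exact ⟨l, rfl, h⟩

theorem Chain.update {next : ℕ → ℕ} {p k v : ℕ} {l : List ℕ} (h : Chain next p l) (hk : k ∉ l) :
    Chain (Function.update next k v) p l := by
  induction l generalizing p with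
  | nil => exact h
  | cons d l ih =>
    rw [List.mem_cons, not_or] at hk
    refine ⟨h.1, ?_⟩
    rw [Function.update_of_ne (Ne.symm hk.1)]
    exact ih h.2 hk.2

theorem Seg.update {q : ℕ → ℕ} {s i v : ℕ} {l : List ℕ} (h : Seg q s l)
    (hi : i < s ∨ s + l.length ≤ i) : Seg (Function.update q i v) s l := by
  induction l generalizing s with
  | nil => trivial
  | cons x l ih =>
    rw [List.length_cons] at hi
    refine ⟨?_, ih h.2 (by omega)⟩
    rw [Function.update_of_ne (by omega), h.1]

theorem Seg.append {q : ℕ → ℕ} {s : ℕ} {l l' : List ℕ} :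
    Seg q s (l ++ l') ↔ Seg q s l ∧ Seg q (s + l.length) l' := by
  induction l generalizing s with
  | nil => simp [Seg]
  | cons x l ih =>
    simp only [List.cons_append, Seg, ih, List.length_cons, and_assoc]
    rw [show s + 1 + l.length = s + (l.length + 1) by ring]

theorem Seg.snoc {q : ℕ → ℕ} {s v : ℕ} {l : List ℕ} (h : Seg q s l) :
    Seg (Function.update q (s + l.length) v) s (l ++ [v]) :=
  Seg.append.2 ⟨h.update (.inr le_rfl), by simp [Seg]⟩

/-! ### The search from one side -/

/-- The state of the search of one side in the graph of the edges whose status is not `2`: it starts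
at `root` and stamps the visited nodes with `stamp`. The visited nodes are stored in the array `qu`
from `start` to `tail - 1`; those from `head` on are not yet scanned. `ptr` points to the unscanned
part of the adjacency list of the node that is being scanned, and `work` is the number of steps made
so far. -/
def Side (N : Net) (next st mk qu : ℕ → ℕ) (root stamp start head tail ptr work : ℕ) : Prop :=
  ∃ scanned todo rem : List ℕ,
    head = start + scanned.length ∧ tail = head + todo.length ∧
    Seg qu start (scanned ++ todo) ∧ (scanned ++ todo).Nodup ∧ root ∈ scanned ++ todo ∧
    (∀ x ∈ scanned ++ todo, x < 2 * N.n ∧ (N.gr (st · ≠ 2)).Reachable root x) ∧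
    (∀ x < 2 * N.n, mk x = stamp ↔ x ∈ scanned ++ todo) ∧
    Chain next ptr rem ∧ (∀ d ∈ rem, d < 2 * N.m ∧ N.src d ∈ scanned) ∧
    (∀ d < 2 * N.m, N.src d ∈ scanned →
      d ∈ rem ∨ (st (d / 2) ≠ 2 → N.dst d ∈ scanned ++ todo)) ∧
    work + rem.length = (scanned.map N.wt).sum

namespace Side

variable {N : Net} {next st mk qu : ℕ → ℕ} {root stamp start head tail ptr work : ℕ}

theorem init (hr : root < 2 * N.n) (hmk : ∀ x < 2 * N.n, mk x = stamp ↔ x = root)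
    (hq : qu start = root) : Side N next st mk qu root stamp start start (start + 1) 0 0 := by
  refine ⟨[], [root], [], ?_⟩
  simpa [Seg, Chain, hq, hr] using hmk

/-- The visited nodes are distinct nodes, so they fit into `2 n` cells. -/
theorem tail_le (h : Side N next st mk qu root stamp start head tail ptr work) :
    start ≤ head ∧ head ≤ tail ∧ tail ≤ start + 2 * N.n := by
  obtain ⟨sc, td, rem, h1, h2, h3, h4, h5, h6, h7, h8, h9, h10, h11⟩ := h
  have : (sc ++ td).length ≤ (List.range (2 * N.n)).length :=
    (h4.subperm fun x hx => List.mem_range.2 (h6 x hx).1).length_le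
  rw [List.length_append, List.length_range] at this
  omega

theorem tail_lt (h : Side N next st mk qu root stamp start head tail ptr work) {y : ℕ}
    (hy : y < 2 * N.n) (hmk : mk y ≠ stamp) : tail < start + 2 * N.n := by
  obtain ⟨sc, td, rem, h1, h2, h3, h4, h5, h6, h7, h8, h9, h10, h11⟩ := h
  have hy' : y ∉ sc ++ td := fun hh => hmk ((h7 y hy).2 hh)
  have : (y :: (sc ++ td)).length ≤ (List.range (2 * N.n)).length := by
    refine ((List.nodup_cons.2 ⟨hy', h4⟩).subperm fun x hx => List.mem_range.2 ?_).length_le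
    rcases List.mem_cons.1 hx with rfl | hx
    exacts [hy, (h6 x hx).1]
  rw [List.length_cons, List.length_append, List.length_range] at this
  omega

/-- The next node is taken from the queue. -/
theorem pop (h : Side N next st mk qu root stamp start head tail 0 work) (hht : head < tail)
    {hd : ℕ → ℕ} (hadj : ∀ x < 2 * N.n, Chain next (hd x) (N.adj x)) :
    qu head < 2 * N.n ∧
      Side N next st mk qu root stamp start (head + 1) tail (hd (qu head)) (work + 1) := by
  obtain ⟨sc, td, rem, rfl, h2, h3, h4, h5, h6, h7, h8, h9, h10, h11⟩ := h
  obtain rfl := h8.eq_nil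
  cases td with
  | nil => simp at h2; omega
  | cons x td =>
    have hx : qu (start + sc.length) = x := (Seg.append.1 h3).2.1
    have hx_lt := (h6 x (by simp)).1
    have hap : sc ++ x :: td = (sc ++ [x]) ++ td := by simp
    rw [hap] at h3 h4 h5 h6 h7 h10
    rw [hx]
    refine ⟨hx_lt, sc ++ [x], td, N.adj x, ?_, ?_, h3, h4, h5, h6, h7, hadj x hx_lt, ?_, ?_, ?_⟩
    · simp; ring
    · simp at h2; omega
    · intro d hd
      rw [Net.mem_adj] at hd
      exact ⟨hd.1, by simp [hd.2]⟩
    · intro d hd hs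
      rw [List.mem_append, List.mem_singleton] at hs
      rcases hs with hs | hs
      · exact .inr ((h10 d hd hs).resolve_left (by simp))
      · exact .inl (Net.mem_adj.2 ⟨hd, hs⟩)
    · simp [Net.wt] at h11 ⊢; omega

theorem dart_lt (h : Side N next st mk qu root stamp start head tail ptr work) (hp : ptr ≠ 0) :
    ptr - 1 < 2 * N.m ∧ (N.gr (st · ≠ 2)).Reachable root (N.src (ptr - 1)) := by
  obtain ⟨sc, td, rem, h1, h2, h3, h4, h5, h6, h7, h8, h9, h10, h11⟩ := h
  obtain ⟨rem', rfl, _⟩ := h8.exists_cons hp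
  have := h9 _ List.mem_cons_self
  exact ⟨this.1, (h6 _ (List.mem_append_left _ this.2)).2⟩

/-- A dart is scanned that is deleted or leads to a visited node. -/
theorem scan_old (h : Side N next st mk qu root stamp start head tail ptr work) (hp : ptr ≠ 0)
    (hold : st ((ptr - 1) / 2) = 2 ∨ mk (N.dst (ptr - 1)) = stamp) :
    Side N next st mk qu root stamp start head tail (next (ptr - 1)) (work + 1) := by
  have hd_lt := (h.dart_lt hp).1
  obtain ⟨sc, td, rem, h1, h2, h3, h4, h5, h6, h7, h8, h9, h10, h11⟩ := h
  obtain ⟨rem', rfl, h8'⟩ := h8.exists_cons hp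
  refine ⟨sc, td, rem', h1, h2, h3, h4, h5, h6, h7, h8',
    fun d hd => h9 d (List.mem_cons_of_mem _ hd), ?_, ?_⟩
  · intro d hd hs
    rcases h10 d hd hs with h | h
    · rcases List.mem_cons.1 h with rfl | h
      · right
        intro hst
        exact (h7 _ (Net.dst_lt hd)).1 (hold.resolve_left hst)
      · exact .inl h
    · exact .inr h
  · rw [List.length_cons] at h11; omega

/-- A dart is scanned that leads to a new node. -/
theorem scan_new (h : Side N next st mk qu root stamp start head tail ptr work) (hp : ptr ≠ 0)
    (hst : st ((ptr - 1) / 2) ≠ 2) (hmk : mk (N.dst (ptr - 1)) ≠ stamp) :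
    Side N next st (Function.update mk (N.dst (ptr - 1)) stamp)
      (Function.update qu tail (N.dst (ptr - 1))) root stamp start head (tail + 1)
      (next (ptr - 1)) (work + 1) := by
  obtain ⟨hd_lt, hreach⟩ := h.dart_lt hp
  have hy := Net.dst_lt hd_lt
  have hreach' := hreach.trans (Net.gr_adj_dart (P := (st · ≠ 2)) hd_lt hst).reachable
  obtain ⟨sc, td, rem, h1, h2, h3, h4, h5, h6, h7, h8, h9, h10, h11⟩ := h
  obtain ⟨rem', rfl, h8'⟩ := h8.exists_cons hp
  set y := N.dst (ptr - 1) with hy_def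
  have hy' : y ∉ sc ++ td := fun hh => hmk ((h7 y hy).2 hh)
  have htail : tail = start + (sc ++ td).length := by rw [List.length_append]; omega
  refine ⟨sc, td ++ [y], rem', h1, ?_, ?_, ?_, ?_, ?_, ?_, h8',
    fun d hd => h9 d (List.mem_cons_of_mem _ hd), ?_, ?_⟩
  · simp; omega
  · rw [← List.append_assoc, htail]
    exact h3.snoc
  · rw [← List.append_assoc, List.nodup_append]
    refine ⟨h4, by simp, ?_⟩
    intro a ha b hb
    rw [List.mem_singleton] at hb
    subst hb
    exact fun hab => hy' (hab ▸ ha)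
  · rw [← List.append_assoc]; exact List.mem_append_left _ h5
  · rw [← List.append_assoc]
    intro x hx
    rcases List.mem_append.1 hx with hx | hx
    · exact h6 x hx
    · rw [List.mem_singleton] at hx; subst hx; exact ⟨hy, hreach'⟩
  · intro x hx
    rw [← List.append_assoc, List.mem_append, List.mem_singleton, ← h7 x hx]
    by_cases hxy : x = y
    · simp [hxy]
    · simp [hxy]
  · intro d hd hs
    rw [← List.append_assoc]
    rcases h10 d hd hs with h | h
    · rcases List.mem_cons.1 h with rfl | h
      · right; intro _; simp [hy_def]
      · exact .inl h
    · exact .inr fun hh => List.mem_append_left _ (h hh)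
  · rw [List.length_cons] at h11; omega

/-- The search of one side does not disturb the search of the other side. -/
theorem frame (h : Side N next st mk qu root stamp start head tail ptr work) {y s i : ℕ}
    (hs : s ≠ stamp) (hy : y < 2 * N.n) (hnot : ¬ (N.gr (st · ≠ 2)).Reachable root y)
    (hi : i < start ∨ start + 2 * N.n ≤ i) (v : ℕ) :
    Side N next st (Function.update mk y s) (Function.update qu i v) root stamp start head tail
      ptr work := by
  have htail := h.tail_le
  obtain ⟨sc, td, rem, h1, h2, h3, h4, h5, h6, h7, h8⟩ := h
  refine ⟨sc, td, rem, h1, h2, h3.update ?_, h4, h5, h6, ?_, h8⟩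
  · rw [List.length_append]; omega
  · intro x hx
    by_cases hxy : x = y
    · subst hxy
      rw [Function.update_self]
      exact ⟨fun hh => absurd hh hs, fun hh => absurd (h6 x hh).2 hnot⟩
    · rw [Function.update_of_ne hxy, h7 x hx]

theorem root_lt (h : Side N next st mk qu root stamp start head tail ptr work) :
    root < 2 * N.n := by
  obtain ⟨sc, td, rem, h1, h2, h3, h4, h5, h6, h7, h8⟩ := h
  exact (h6 root h5).1

theorem work_le (h : Side N next st mk qu root stamp start head tail ptr work) :
    work ≤ N.compWt (st · ≠ 2) root := by
  have hr := h.root_lt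
  obtain ⟨sc, td, rem, h1, h2, h3, h4, h5, h6, h7, h8, h9, h10, h11⟩ := h
  have : (sc.map N.wt).sum ≤ N.compWt (st · ≠ 2) root := by
    rw [← List.sum_toFinset _ (List.nodup_append.1 h4).1]
    refine Finset.sum_le_sum_of_subset fun x hx => ?_
    rw [Net.mem_comp hr]
    exact (h6 x (List.mem_append_left _ (List.mem_toFinset.1 hx))).2
  omega

/-- When nothing is left to scan, the visited nodes form the component of the root. -/
theorem complete (h : Side N next st mk qu root stamp start head tail 0 work)
    (hht : tail ≤ head) :
    work = N.compWt (st · ≠ 2) root ∧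
      (∀ x < 2 * N.n, mk x = stamp ↔ (N.gr (st · ≠ 2)).Reachable root x) ∧
      ∃ vis : List ℕ, tail = start + vis.length ∧ Seg qu start vis ∧ vis.Nodup ∧
        vis.toFinset = N.comp (st · ≠ 2) root := by
  have hr := h.root_lt
  obtain ⟨sc, td, rem, h1, h2, h3, h4, h5, h6, h7, h8, h9, h10, h11⟩ := h
  obtain rfl := h8.eq_nil
  obtain rfl : td = [] := List.eq_nil_of_length_eq_zero (by omega)
  rw [List.append_nil] at *
  have hclosed : ∀ x, (N.gr (st · ≠ 2)).Reachable root x → x ∈ sc := by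
    intro x hx
    rw [SimpleGraph.reachable_iff_reflTransGen] at hx
    induction hx with
    | refl => exact h5
    | tail _ hbc ih =>
      obtain ⟨d, hd, hP, rfl, rfl⟩ := Net.exists_dart hbc
      exact (h10 d hd ih).resolve_left (by simp) hP
  have hset : sc.toFinset = N.comp (st · ≠ 2) root := by
    ext x
    rw [List.mem_toFinset, Net.mem_comp hr]
    exact ⟨fun hx => (h6 x hx).2, hclosed x⟩
  refine ⟨?_, ?_, sc, ?_, h3, h4, hset⟩
  · rw [Net.compWt, ← hset, List.sum_toFinset _ h4]
    simpa using h11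
  · intro x hx
    rw [h7 x hx]
    exact ⟨fun hx => (h6 x hx).2, hclosed x⟩
  · simp at h2; omega

end Side

/-! ### The queue of deleted edges -/

/-- The first `pushed` cells of the array `del` contain the edges whose status is not `0`, and the
first `popped` of them have the status `2`, the other ones the status `1`. -/
structure Queue (m : ℕ) (st del : ℕ → ℕ) (popped pushed : ℕ) : Prop where
  le : popped ≤ pushed
  lt : ∀ i < pushed, del i < m
  status : ∀ i < pushed, st (del i) = if i < popped then 2 else 1
  inj : ∀ i < pushed, ∀ j < pushed, del i = del j → i = j
  surj : ∀ e < m, st e ≠ 0 → ∃ i < pushed, del i = e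

namespace Queue

variable {m : ℕ} {st del : ℕ → ℕ} {popped pushed : ℕ}

theorem empty : Queue m (fun _ => 0) del 0 0 where
  le := le_rfl
  lt i hi := by omega
  status i hi := by omega
  inj i hi := by omega
  surj e he h := absurd rfl h

theorem push (h : Queue m st del popped pushed) {e : ℕ} (he : e < m) (hst : st e = 0) :
    Queue m (Function.update st e 1) (Function.update del pushed e) popped (pushed + 1) := by
  have hne : ∀ i < pushed, del i ≠ e := by
    intro i hi hie
    have := h.status i hi
    rw [hie, hst] at this
    split at this <;> omega
  have hle := h.le
  refine ⟨by omega, fun i hi => ?_, fun i hi => ?_, fun i hi j hj => ?_, fun f hf hf0 => ?_⟩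
  · by_cases hi' : i = pushed
    · simpa [hi'] using he
    · simpa [hi'] using h.lt i (by omega)
  · by_cases hi' : i = pushed
    · simp [hi', hle]
    · simpa [hi', hne i (by omega)] using h.status i (by omega)
  · by_cases hi' : i = pushed <;> by_cases hj' : j = pushed
    · omega
    · simp only [hi', hj', Function.update_self, ne_eq, not_false_eq_true, Function.update_of_ne]
      exact fun hh => absurd hh.symm (hne j (by omega))
    · simp only [hi', hj', Function.update_self, ne_eq, not_false_eq_true, Function.update_of_ne]
      exact fun hh => absurd hh (hne i (by omega))
    · simpa [hi', hj'] using h.inj i (by omega) j (by omega)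
  · by_cases hfe : f = e
    · exact ⟨pushed, by omega, by simp [hfe]⟩
    · rw [Function.update_of_ne hfe] at hf0
      obtain ⟨i, hi, rfl⟩ := h.surj f hf hf0
      exact ⟨i, by omega, by rw [Function.update_of_ne (by omega)]⟩

theorem pop (h : Queue m st del popped pushed) (hlt : popped < pushed) :
    Queue m (Function.update st (del popped) 2) del (popped + 1) pushed := by
  refine ⟨hlt, h.lt, fun i hi => ?_, h.inj, fun f hf hf0 => ?_⟩
  · by_cases hi' : i = popped
    · simp [hi']
    · rw [Function.update_of_ne fun hh => hi' (h.inj i hi popped hlt hh), h.status i hi]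
      split <;> split <;> omega
  · by_cases hfe : f = del popped
    · exact ⟨popped, hlt, hfe.symm⟩
    · rw [Function.update_of_ne hfe] at hf0
      exact h.surj f hf hf0

theorem pushed_le (h : Queue m st del popped pushed) : pushed ≤ m := by
  have := Finset.card_le_card_of_injOn (s := Finset.range pushed) (t := Finset.range m) del
    (fun i hi => by simpa using h.lt i (by simpa using hi))
    (fun i hi j hj => h.inj i (by simpa using hi) j (by simpa using hj))
  simpa using this

theorem pushed_eq_iff (h : Queue m st del popped pushed) :
    pushed = m ↔ ∀ e < m, st e ≠ 0 := by
  have hinj : Set.InjOn del (Finset.range pushed) := fun i hi j hj =>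
    h.inj i (by simpa using hi) j (by simpa using hj)
  have himg : (Finset.range pushed).image del = (Finset.range m).filter (st · ≠ 0) := by
    ext e
    simp only [Finset.mem_image, Finset.mem_range, Finset.mem_filter]
    constructor
    · rintro ⟨i, hi, rfl⟩
      refine ⟨h.lt i hi, ?_⟩
      rw [h.status i hi]
      split <;> simp
    · exact fun he => h.surj e he.1 he.2
  have hcard : pushed = ((Finset.range m).filter (st · ≠ 0)).card := by
    rw [← himg, Finset.card_image_of_injOn hinj, Finset.card_range]
  constructor
  · intro hm e he
    have := Finset.card_filter_eq_iff.1 ((hcard.symm.trans hm).trans (Finset.card_range m).symm)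
    exact this e (Finset.mem_range.2 he)
  · intro hall
    rw [hcard, Finset.filter_true_of_mem fun e he => hall e (Finset.mem_range.1 he),
      Finset.card_range]

end Queue
end LamanRAM

/-! ### The program -/

namespace LamanRAM

/-- Sequential execution of a list of programs. -/
def Cmd.block : List Cmd → Cmd
  | [] => .skip
  | [c] => c
  | c :: l => .seq c (block l)

/-- Compute the other copy of a node. -/
def twinCmd (d a : Var) : Cmd :=
  .ite (.lt a Con.verts) (.add d a Con.verts) (.sub d a Con.verts)

/-- Exchange the roles of the two sides of the search. -/
def swapSides : Cmd := .block [
  .set .tmp Var.stampA, .set .stampA Var.stampB, .set .stampB Var.tmp,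
  .set .tmp Var.startA, .set .startA Var.startB, .set .startB Var.tmp,
  .set .tmp Var.headA, .set .headA Var.headB, .set .headB Var.tmp,
  .set .tmp Var.tailA, .set .tailA Var.tailB, .set .tailB Var.tmp,
  .set .tmp Var.ptrA, .set .ptrA Var.ptrB, .set .ptrB Var.tmp]

/-- One step of the search on the current side, after which the sides are exchanged. -/
def exploreStep : Cmd :=
  .ite (.eq Var.ptrA Con.zero)
    (.ite (.lt Var.headA Var.tailA)
      (.block [
        .rd .node .queue Var.headA, .add .headA Var.headA Con.one,
        .rd .ptrA .head Var.node, swapSides])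
      (.set .done Con.one))
    (.block [
      .sub .dart Var.ptrA Con.one, .rd .ptrA .next Var.dart,
      .rd .edge .eid Var.dart, .rd .tmp .status Var.edge,
      .ite (.eq Var.tmp Con.two) .skip (.block [
        .rd .nbr .dst Var.dart, .rd .tmp .mark Var.nbr,
        .ite (.eq Var.tmp Var.stampA) .skip (.block [
          .wr .mark Var.nbr Var.stampA, .wr .queue Var.tailA Var.nbr,
          .add .tailA Var.tailA Con.one])]),
      swapSides])

/-- Prepare the parallel search from `endA` and `endB`. -/
def exploreInit : Cmd := .block [
  .add .stampA Var.stamp Con.one, .add .stampB Var.stampA Con.one, .set .stamp Var.stampB,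
  .set .startA Con.zero, .set .headA Con.zero, .set .tailA Con.one, .set .ptrA Con.zero,
  .wr .queue Var.headA Var.endA, .wr .mark Var.endA Var.stampA,
  .set .startB Con.nodes, .set .headB Con.nodes, .add .tailB Con.nodes Con.one,
  .set .ptrB Con.zero,
  .wr .queue Var.headB Var.endB, .wr .mark Var.endB Var.stampB,
  .set .done Con.zero]

/-- One step of the scan for edges that have to be deleted because the other copies of their
endpoints have been separated. -/
def pushStep : Cmd :=
  .ite (.eq Var.ptr Con.zero)
    (.ite (.lt Var.pos Var.tailA)
      (.block [
        .rd .node .queue Var.pos, .add .pos Var.pos Con.one,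
        twinCmd .twin .node, .rd .ptr .head Var.twin])
      (.set .done Con.one))
    (.block [
      .sub .dart Var.ptr Con.one, .rd .ptr .next Var.dart,
      .rd .edge .eid Var.dart, .rd .tmp .status Var.edge,
      .ite (.eq Var.tmp Con.zero)
        (.block [
          .rd .nbr .dst Var.dart, twinCmd .twin .nbr, .rd .tmp .mark Var.twin,
          .ite (.eq Var.tmp Var.stampA) .skip (.block [
            .wr .status Var.edge Con.one, .wr .del Var.pushed Var.edge,
            .add .pushed Var.pushed Con.one])])
        .skip])

/-- Prepare the scan. -/
def pushInit : Cmd := .block [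
  .set .pos Var.startA, .set .ptr Con.zero, .set .done Con.zero]

/-- Find the lighter one of the components of `endA` and `endB`, and mark and queue the edges that
have to be deleted. -/
def splitCmd : Cmd := .block [
  exploreInit, .loop (.eq Var.done Con.zero) exploreStep,
  pushInit, .loop (.eq Var.done Con.zero) pushStep]

/-- Delete the next edge from the queue. -/
def popCmd : Cmd := .block [
  .rd .edge .del Var.popped, .add .popped Var.popped Con.one,
  .wr .status Var.edge Con.two, .add .dart Var.edge Var.edge,
  .rd .endB .dst Var.dart, .add .dart Var.dart Con.one, .rd .endA .dst Var.dart]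

/-- Delete edges until the remaining ones are supported. -/
def pruneCmd : Cmd := .block [
  .set .endA Con.zero, .set .endB Con.verts, splitCmd,
  .loop (.lt Var.popped Var.pushed) (.seq popCmd splitCmd),
  .ite (.eq Var.pushed Con.edges) (.set .out Con.one) (.set .out Con.zero)]

@[simp] theorem Cmd.vc_set (C : Ctx) (d a Q σ) :
    (Cmd.set d a).vc C Q σ ↔ Q (σ.setV d (a.val C σ)) := Iff.rfl

@[simp] theorem Cmd.vc_add (C : Ctx) (d a b Q σ) : (Cmd.add d a b).vc C Q σ ↔
    a.val C σ + b.val C σ ≤ C.len ∧ Q (σ.setV d (a.val C σ + b.val C σ)) := Iff.rfl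

@[simp] theorem Cmd.vc_sub (C : Ctx) (d a b Q σ) :
    (Cmd.sub d a b).vc C Q σ ↔ Q (σ.setV d (a.val C σ - b.val C σ)) := Iff.rfl

@[simp] theorem Cmd.vc_rd (C : Ctx) (d j i Q σ) : (Cmd.rd d j i).vc C Q σ ↔
    i.val C σ < C.len ∧ Q (σ.setV d (σ.a j (i.val C σ))) := Iff.rfl

@[simp] theorem Cmd.vc_wr (C : Ctx) (j i a Q σ) : (Cmd.wr j i a).vc C Q σ ↔
    i.val C σ < C.len ∧ Q (σ.setA j (i.val C σ) (a.val C σ)) := Iff.rfl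

@[simp] theorem Cmd.vc_skip (C : Ctx) (Q σ) : Cmd.skip.vc C Q σ ↔ Q σ := Iff.rfl

@[simp] theorem Cmd.vc_seq (C : Ctx) (p q Q σ) :
    (Cmd.seq p q).vc C Q σ ↔ p.vc C (q.vc C Q) σ := Iff.rfl

@[simp] theorem Cmd.vc_ite (C : Ctx) (b p q Q σ) : (Cmd.ite b p q).vc C Q σ ↔
    (b.holds C σ → p.vc C Q σ) ∧ (¬ b.holds C σ → q.vc C Q σ) := Iff.rfl

/-- The constants and the array length have the intended values. -/
structure Setup (N : Net) (C : Ctx) : Prop where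
  zero : C.con .zero = 0
  one : C.con .one = 1
  two : C.con .two = 2
  verts : C.con .verts = N.n
  nodes : C.con .nodes = 2 * N.n
  edges : C.con .edges = N.m
  len : C.len = 4 * N.n

/-- The arrays that describe the forest have the intended contents. -/
structure Static (N : Net) (a : Arr → ℕ → ℕ) : Prop where
  dst : ∀ d < 2 * N.m, a .dst d = N.dst d
  eid : ∀ d < 2 * N.m, a .eid d = d / 2
  adj : ∀ x < 2 * N.n, Chain (a .next) (a .head x) (N.adj x)

theorem Setup.vc_twin {N : Net} {C : Ctx} (hC : Setup N C) {d a : Var} {Q : Cfg → Prop} {σ : Cfg}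
    (ha : σ.v a < 2 * N.n) (hQ : Q (σ.setV d (N.tw (σ.v a)))) : (twinCmd d a).vc C Q σ := by
  have hn := N.two_le
  unfold twinCmd
  unfold Net.tw at hQ
  simp only [Cmd.vc_ite, Cmd.vc_add, Cmd.vc_sub, Opd.val_var, Opd.val_con, Cond.holds_lt,
    hC.verts, hC.len]
  constructor
  · intro h
    rw [if_pos h] at hQ
    exact ⟨by omega, hQ⟩
  · intro h
    rwa [if_neg h] at hQ

/-! ### The parallel search -/

/-- The search on the current side. -/
def SideA (N : Net) (σ : Cfg) (root work : ℕ) : Prop :=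
  Side N (σ.a .next) (σ.a .status) (σ.a .mark) (σ.a .queue) root (σ.v .stampA) (σ.v .startA)
    (σ.v .headA) (σ.v .tailA) (σ.v .ptrA) work

/-- The search on the other side. -/
def SideB (N : Net) (σ : Cfg) (root work : ℕ) : Prop :=
  Side N (σ.a .next) (σ.a .status) (σ.a .mark) (σ.a .queue) root (σ.v .stampB) (σ.v .startB)
    (σ.v .headB) (σ.v .tailB) (σ.v .ptrB) work

/-- The parts of a configuration that the parallel search does not change. -/
structure ExploreFrame (σ₀ σ : Cfg) : Prop where
  arr : ∀ j, j ≠ .mark → j ≠ .queue → σ.a j = σ₀.a j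
  popped : σ.v .popped = σ₀.v .popped
  pushed : σ.v .pushed = σ₀.v .pushed
  stamp : σ.v .stamp = σ₀.v .stamp + 2

/-- The invariant of the parallel search. The numbers `a` and `b` count the steps made on the
current side and on the other side. The two sides use different stamps and different halves of the
array `queue`. -/
structure ExploreInv (N : Net) (σ₀ σ : Cfg) (rA rB a b : ℕ) : Prop where
  frame : ExploreFrame σ₀ σ
  mark_le : ∀ x < 2 * N.n, σ.a .mark x ≤ σ.v .stamp
  stampA_le : σ.v .stampA ≤ σ.v .stamp
  stampB_le : σ.v .stampB ≤ σ.v .stamp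
  stamp_ne : σ.v .stampA ≠ σ.v .stampB
  start : σ.v .startA = 0 ∧ σ.v .startB = 2 * N.n ∨ σ.v .startA = 2 * N.n ∧ σ.v .startB = 0
  not_reachable : ¬ (N.gr (σ.a .status · ≠ 2)).Reachable rA rB
  sideA : SideA N σ rA a
  sideB : SideB N σ rB b

/-- The configuration after the exchange of the sides. -/
def Cfg.swap (σ : Cfg) : Cfg where
  a := σ.a
  v
    | .stampA => σ.v .stampB | .stampB => σ.v .stampA
    | .startA => σ.v .startB | .startB => σ.v .startA
    | .headA => σ.v .headB | .headB => σ.v .headA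
    | .tailA => σ.v .tailB | .tailB => σ.v .tailA
    | .ptrA => σ.v .ptrB | .ptrB => σ.v .ptrA
    | .tmp => σ.v .ptrA
    | x => σ.v x

theorem vc_swapSides {C : Ctx} {Q : Cfg → Prop} {σ : Cfg} (h : Q σ.swap) :
    swapSides.vc C Q σ := by
  simp only [swapSides, Cmd.block, Cmd.vc_seq, Cmd.vc_set, Opd.val_var]
  convert h using 1
  ext x
  · cases x <;> simp [Cfg.swap]
  · rfl

theorem ExploreInv.swap {N : Net} {σ₀ σ : Cfg} {rA rB a b : ℕ}
    (h : ExploreInv N σ₀ σ rA rB a b) : ExploreInv N σ₀ σ.swap rB rA b a where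
  frame := ⟨h.frame.arr, h.frame.popped, h.frame.pushed, h.frame.stamp⟩
  mark_le := h.mark_le
  stampA_le := h.stampB_le
  stampB_le := h.stampA_le
  stamp_ne := h.stamp_ne.symm
  start := h.start.symm.imp And.symm And.symm
  not_reachable := fun h' => h.not_reachable h'.symm
  sideA := h.sideB
  sideB := h.sideA

/-- A step either advances the search on the current side, or finds that this side is complete. -/
theorem exploreStep_vc {N : Net} {C : Ctx} (hC : Setup N C) {σ₀ σ : Cfg} {rA rB a b : ℕ}
    (hS : Static N σ₀.a) (h : ExploreInv N σ₀ σ rA rB a b) (hdone : σ.v .done = 0) :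
    exploreStep.vc C (fun σ' =>
      (ExploreInv N σ₀ σ' rB rA b (a + 1) ∧ σ'.v .done = 0) ∨
      (ExploreInv N σ₀ σ' rA rB a b ∧ σ'.v .done = 1 ∧ σ'.v .ptrA = 0 ∧
        σ'.v .tailA ≤ σ'.v .headA)) σ := by
  have hn := N.two_le
  have hm := N.card
  have hA : Side N _ _ _ _ _ _ _ _ _ _ _ := h.sideA
  have hB : Side N _ _ _ _ _ _ _ _ _ _ _ := h.sideB
  have hlen := hC.len
  have htail := hA.tail_le
  have hdst : σ.a .dst = σ₀.a .dst := h.frame.arr _ (by simp) (by simp)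
  have heid : σ.a .eid = σ₀.a .eid := h.frame.arr _ (by simp) (by simp)
  have hnext : σ.a .next = σ₀.a .next := h.frame.arr _ (by simp) (by simp)
  have hhead : σ.a .head = σ₀.a .head := h.frame.arr _ (by simp) (by simp)
  have hstart := h.start
  simp only [exploreStep, Cmd.block, Cmd.vc_ite, Cmd.vc_seq, Cmd.vc_rd, Cmd.vc_add, Cmd.vc_sub,
    Cmd.vc_set, Cond.holds_eq, Cond.holds_lt, Opd.val_var, Opd.val_con, hC.zero, hC.one, hC.len]
  refine ⟨fun hp => ⟨fun hlt => ?_, fun hlt => ?_⟩, fun hp => ?_⟩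
  -- The adjacency list is exhausted, and the next node is taken from the queue.
  · rw [hp] at hA
    obtain ⟨hx, hA'⟩ := hA.pop hlt (hd := σ.a .head)
      (by rw [hnext, hhead]; exact hS.adj)
    refine ⟨by omega, by simp; omega, by simp; omega, vc_swapSides ?_⟩
    refine .inl ⟨ExploreInv.swap ⟨?_, ?_, ?_, ?_, ?_, ?_, ?_, ?_, ?_⟩, ?_⟩
    · exact ⟨by simpa using h.frame.arr, by simpa using h.frame.popped,
        by simpa using h.frame.pushed, by simpa using h.frame.stamp⟩
    · simpa using h.mark_le
    · simpa using h.stampA_le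
    · simpa using h.stampB_le
    · simpa using h.stamp_ne
    · simpa using h.start
    · simpa using h.not_reachable
    · simpa [SideA] using hA'
    · simpa [SideB] using hB
    · simpa [Cfg.swap] using hdone
  -- The queue is empty, so this side is complete.
  · refine .inr ⟨⟨?_, ?_, ?_, ?_, ?_, ?_, ?_, ?_, ?_⟩, ?_, ?_⟩
    · exact ⟨by simpa using h.frame.arr, by simpa using h.frame.popped,
        by simpa using h.frame.pushed, by simpa using h.frame.stamp⟩
    · simpa using h.mark_le
    · simpa using h.stampA_le
    · simpa using h.stampB_le
    · simpa using h.stamp_ne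
    · simpa using h.start
    · simpa using h.not_reachable
    · simpa [SideA] using hA
    · simpa [SideB] using hB
    · simp
    · simpa using ⟨hp, not_lt.1 hlt⟩
  -- The next dart is scanned.
  · obtain ⟨hd, hreach⟩ := hA.dart_lt hp
    have hd_dst : σ.a .dst (σ.v .ptrA - 1) = N.dst (σ.v .ptrA - 1) := by
      rw [hdst]; exact hS.dst _ hd
    have hd_eid : σ.a .eid (σ.v .ptrA - 1) = (σ.v .ptrA - 1) / 2 := by
      rw [heid]; exact hS.eid _ hd
    have hy := Net.dst_lt hd
    simp only [Cmd.vc_skip, Cmd.vc_wr, Cfg.setV_v, Cfg.setV_a, reduceCtorEq, if_true, if_false,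
      Opd.val_var, hC.two, hC.len, hd_dst, hd_eid]
    -- The dart is ignored if it is deleted or leads to a visited node.
    have hold : (σ.a .status ((σ.v .ptrA - 1) / 2) = 2 ∨
        σ.a .mark (N.dst (σ.v .ptrA - 1)) = σ.v .stampA) → ∀ σ' : Cfg, σ'.a = σ.a →
        (∀ x, x ≠ .dart → x ≠ .ptrA → x ≠ .edge → x ≠ .tmp → x ≠ .nbr → σ'.v x = σ.v x) →
        σ'.v .ptrA = σ.a .next (σ.v .ptrA - 1) →
        ExploreInv N σ₀ σ'.swap rB rA b (a + 1) ∧ σ'.swap.v .done = 0 := by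
      intro hor σ' ha hv hv'
      have hA' := hA.scan_old hp hor
      refine ⟨ExploreInv.swap ⟨⟨?_, ?_, ?_, ?_⟩, ?_, ?_, ?_, ?_, ?_, ?_, ?_, ?_⟩, ?_⟩
      · rw [ha]; exact h.frame.arr
      · rw [hv _ (by simp) (by simp) (by simp) (by simp) (by simp)]; exact h.frame.popped
      · rw [hv _ (by simp) (by simp) (by simp) (by simp) (by simp)]; exact h.frame.pushed
      · rw [hv _ (by simp) (by simp) (by simp) (by simp) (by simp)]; exact h.frame.stamp
      · simpa [ha, hv] using h.mark_le
      · simpa [hv] using h.stampA_le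
      · simpa [hv] using h.stampB_le
      · simpa [hv] using h.stamp_ne
      · simpa [hv] using h.start
      · simpa [ha] using h.not_reachable
      · simpa [SideA, ha, hv, hv'] using hA'
      · simpa [SideB, ha, hv] using hB
      · simpa [Cfg.swap, hv] using hdone
    refine ⟨by omega, by omega, by omega, fun hst => ?_, fun hst => ?_⟩
    · refine vc_swapSides (.inl (hold (.inl hst) _ rfl ?_ ?_))
      · intro x h1 h2 h3 h4 h5; simp [*]
      · simp
    · refine ⟨by omega, by omega, fun hmk => ?_, fun hmk => ?_⟩
      · refine vc_swapSides (.inl (hold (.inr hmk) _ rfl ?_ ?_))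
        · intro x h1 h2 h3 h4 h5; simp [*]
        · simp
      -- Otherwise its head is visited. It is not in the component of the other root, so the other
      -- search is not disturbed.
      · have hlt := hA.tail_lt hy hmk
        refine ⟨by omega, by simp; omega, by simp [hC.one]; omega, vc_swapSides (.inl ?_)⟩
        have hA' := hA.scan_new hp hst hmk
        have hreach' := hreach.trans (Net.gr_adj_dart (P := (σ.a .status · ≠ 2)) hd hst).reachable
        have hB' := hB.frame (y := N.dst (σ.v .ptrA - 1)) (s := σ.v .stampA) (i := σ.v .tailA)
          h.stamp_ne hy (fun hh => h.not_reachable (hreach'.trans hh.symm)) (by omega)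
          (N.dst (σ.v .ptrA - 1))
        refine ⟨ExploreInv.swap ⟨⟨?_, ?_, ?_, ?_⟩, ?_, ?_, ?_, ?_, ?_, ?_, ?_, ?_⟩, ?_⟩
        · intro j h1 h2
          simpa [h1, h2] using h.frame.arr j h1 h2
        · simpa using h.frame.popped
        · simpa using h.frame.pushed
        · simpa using h.frame.stamp
        · intro x hx
          have := h.mark_le x hx
          have := h.stampA_le
          simp only [Cfg.setV_v, Cfg.setV_a, Cfg.setA_a, Cfg.setA_v, reduceCtorEq, if_true,
            if_false, Function.update_apply]
          split <;> assumption
        · simpa using h.stampA_le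
        · simpa using h.stampB_le
        · simpa using h.stamp_ne
        · simpa using h.start
        · simpa using h.not_reachable
        · simpa [SideA, hC.one] using hA'
        · simpa [SideB] using hB'
        · simpa [Cfg.swap] using hdone

/-- What a split needs: the data of the forest, marks that do not exceed `stamp`, a consistent
queue, and two nodes in different components. -/
structure SplitPre (N : Net) (σ : Cfg) : Prop where
  static : Static N σ.a
  mark_le : ∀ x < 2 * N.n, σ.a .mark x ≤ σ.v .stamp
  stamp_le : σ.v .stamp + 2 ≤ 4 * N.n
  queue : Queue N.m (σ.a .status) (σ.a .del) (σ.v .popped) (σ.v .pushed)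
  endA_lt : σ.v .endA < 2 * N.n
  endB_lt : σ.v .endB < 2 * N.n
  not_reachable : ¬ (N.gr (σ.a .status · ≠ 2)).Reachable (σ.v .endA) (σ.v .endB)

/-- The two stamps are larger than all marks, so in the beginning only the two roots count as
visited. -/
theorem exploreInit_vc {N : Net} {C : Ctx} (hC : Setup N C) {σ : Cfg} (h : SplitPre N σ) :
    exploreInit.vc C (fun σ' =>
      ExploreInv N σ σ' (σ.v .endA) (σ.v .endB) 0 0 ∧ σ'.v .done = 0) σ := by
  have hn := N.two_le
  have hA := h.endA_lt
  have hB := h.endB_lt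
  have hst := h.stamp_le
  have hne : σ.v .endA ≠ σ.v .endB := fun hh => h.not_reachable (hh ▸ .refl _)
  have hmk : ∀ x < 2 * N.n, σ.a .mark x ≠ σ.v .stamp + 1 ∧ σ.a .mark x ≠ σ.v .stamp + 1 + 1 := by
    intro x hx
    have := h.mark_le x hx
    omega
  simp only [exploreInit, Cmd.block, Cmd.vc_seq, Cmd.vc_wr, Cmd.vc_add, Cmd.vc_set, Opd.val_var,
    Opd.val_con, hC.zero, hC.one, hC.nodes, hC.len, Cfg.setV_v, Cfg.setA_v,
    reduceCtorEq, if_true, if_false]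
  refine ⟨by omega, by omega, by omega, by omega, by omega, by omega, by omega, ?_, ?_⟩
  · refine ⟨⟨?_, ?_, ?_, ?_⟩, ?_, ?_, ?_, ?_, ?_, ?_, ?_, ?_⟩
    · intro j h1 h2; simp [h1, h2]
    · simp
    · simp
    · simp
    · intro x hx
      have := h.mark_le x hx
      simp only [Cfg.setV_v, Cfg.setV_a, Cfg.setA_a, Cfg.setA_v, reduceCtorEq, if_true,
        if_false, Function.update_apply]
      split
      · omega
      · split <;> omega
    · simp
    · simp
    · simp
    · simp
    · simpa using h.not_reachable
    · simp only [SideA, Cfg.setV_v, Cfg.setV_a, Cfg.setA_a, Cfg.setA_v, reduceCtorEq, if_true,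
        if_false]
      refine Side.init hA ?_ ?_
      · intro x hx
        have := hmk x hx
        simp only [Function.update_apply]
        split
        · omega
        · split <;> omega
      · rw [Function.update_of_ne (by omega), Function.update_self]
    · simp only [SideB, Cfg.setV_v, Cfg.setV_a, Cfg.setA_a, Cfg.setA_v, reduceCtorEq, if_true,
        if_false]
      refine Side.init hB ?_ ?_
      · intro x hx
        have := hmk x hx
        simp only [Function.update_apply]
        split
        · omega
        · split <;> omega
      · rw [Function.update_self]
  · simp

theorem exploreStep_cost : exploreStep.cost = 34 := rfl

/-- The parallel search finds the lighter component, and needs a number of steps that is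
proportional to its weight. -/
theorem exploreLoop_wp {N : Net} {C : Ctx} (hC : Setup N C) {σ₀ σ : Cfg} {u v : ℕ}
    (hS : Static N σ₀.a) (h : ExploreInv N σ₀ σ u v 0 0) (hdone : σ.v .done = 0) :
    (Cmd.loop (.eq Var.done Con.zero) exploreStep).wp C (fun σ' t => ∃ r r' a b,
      (r = u ∧ r' = v ∨ r = v ∧ r' = u) ∧ ExploreInv N σ₀ σ' r r' a b ∧ a ≤ b ∧
      σ'.v .ptrA = 0 ∧ σ'.v .tailA ≤ σ'.v .headA ∧ t ≤ 70 * a + 71) σ := by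
  have hst : ∀ σ' rA rB a b, ExploreInv N σ₀ σ' rA rB a b → σ'.a .status = σ.a .status :=
    fun σ' rA rB a b h' => by
      rw [h'.frame.arr .status (by simp) (by simp), h.frame.arr .status (by simp) (by simp)]
  set W := min (N.compWt (σ.a .status · ≠ 2) u) (N.compWt (σ.a .status · ≠ 2) v) with hW
  -- At most `2 * W + 1` steps can be made before the lighter side is complete.
  let I : Cfg → ℕ → Prop := fun σ' φ => ∃ rA rB a b,
    (rA = u ∧ rB = v ∨ rA = v ∧ rB = u) ∧ ExploreInv N σ₀ σ' rA rB a b ∧ a ≤ b ∧ b ≤ a + 1 ∧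
      (σ'.v .done = 0 ∧ φ = 35 * (2 * W + 2 - (a + b)) ∨
        σ'.v .done = 1 ∧ φ = 0 ∧ σ'.v .ptrA = 0 ∧ σ'.v .tailA ≤ σ'.v .headA)
  have key := Cmd.wp_loop (C := C) (b := .eq Var.done Con.zero) (p := exploreStep) I ?_
    (σ := σ) (φ := 35 * (2 * W + 2)) ?_
  · refine Cmd.wp_mono key ?_
    rintro σ' t ⟨hb, φ', ⟨rA, rB, a, b, hor, hinv, hab, hab', hd⟩, ht⟩
    rcases hd with ⟨hd, _⟩ | ⟨_, _, hp, hht⟩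
    · exact absurd (by simpa [hC.zero] using hd) hb
    · refine ⟨rA, rB, a, b, hor, hinv, hab, hp, hht, ?_⟩
      have hA : Side N _ _ _ _ _ _ _ _ _ _ _ := hinv.sideA
      rw [hp] at hA
      have ha := (hA.complete hht).1
      rw [hst _ _ _ _ _ hinv] at ha
      have : W ≤ a := by
        rw [ha]
        rcases hor with ⟨rfl, _⟩ | ⟨rfl, _⟩
        exacts [min_le_left _ _, min_le_right _ _]
      omega
  · rintro σ' φ ⟨rA, rB, a, b, hor, hinv, hab, hab', hd⟩ hb
    rcases hd with ⟨hd, rfl⟩ | ⟨hd, _⟩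
    · have hA : a ≤ N.compWt (σ'.a .status · ≠ 2) rA := Side.work_le hinv.sideA
      have hB : b ≤ N.compWt (σ'.a .status · ≠ 2) rB := Side.work_le hinv.sideB
      rw [hst _ _ _ _ _ hinv] at hA hB
      have hlt : a + b ≤ 2 * W + 1 := by
        rcases hor with ⟨rfl, rfl⟩ | ⟨rfl, rfl⟩ <;> omega
      refine Cmd.wp_mono (Cmd.wp_of_vc (exploreStep_vc hC hS hinv hd)) ?_
      rintro σ'' t ⟨ht, h'⟩
      rw [exploreStep_cost] at ht
      rcases h' with ⟨h1, h2⟩ | ⟨h1, h2, h3, h4⟩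
      · exact ⟨_, ⟨rB, rA, b, a + 1, by tauto, h1, hab', by omega, .inl ⟨h2, rfl⟩⟩, by omega⟩
      · exact ⟨0, ⟨rA, rB, a, b, hor, h1, hab, hab', .inr ⟨h2, rfl, h3, h4⟩⟩, by omega⟩
    · simp [hC.zero, hd] at hb
  · exact ⟨u, v, 0, 0, by tauto, h, le_rfl, by omega, .inl ⟨hdone, by simp⟩⟩

/-! ### The scan for separated edges -/

/-- The parts of a configuration that the scan does not change. -/
structure PushFrame (σ₀ σ : Cfg) : Prop where
  arr : ∀ j, j ≠ .status → j ≠ .del → σ.a j = σ₀.a j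
  popped : σ.v .popped = σ₀.v .popped
  stamp : σ.v .stamp = σ₀.v .stamp
  stampA : σ.v .stampA = σ₀.v .stampA
  tailA : σ.v .tailA = σ₀.v .tailA

/-- The change of the status of an edge in a split: it is queued if it was fresh and exactly one of
the nodes `x` and `y` has the property `R`. -/
def Pushed (N : Net) (R : ℕ → Prop) (st st' : ℕ → ℕ) : Prop :=
  ∀ e < N.m, (st e ≠ 0 → st' e = st e) ∧ (st e = 0 → st' e = 0 ∨
    st' e = 1 ∧ ¬ (R (N.tw (N.X e)) ↔ R (N.tw (N.Y e))))

/-- The invariant of the scan. The property `R` says that a node belongs to the lighter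
component. The nodes in `todo` are not yet handled, the darts in `rem` remain at the current node,
and `k` counts the steps that are left. All other darts whose tail has its other copy in the lighter
component have been checked. -/
def PushInv (N : Net) (R : ℕ → Prop) (σ₀ σ : Cfg) (k : ℕ) : Prop :=
  PushFrame σ₀ σ ∧
  Queue N.m (σ.a .status) (σ.a .del) (σ.v .popped) (σ.v .pushed) ∧
  Pushed N R (σ₀.a .status) (σ.a .status) ∧
  ∃ todo rem : List ℕ,
    Seg (σ.a .queue) (σ.v .pos) todo ∧ σ.v .tailA = σ.v .pos + todo.length ∧
    (∀ x ∈ todo, x < 2 * N.n ∧ R x) ∧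
    Chain (σ.a .next) (σ.v .ptr) rem ∧
    (∀ d ∈ rem, d < 2 * N.m ∧ R (N.tw (N.src d))) ∧
    (∀ d < 2 * N.m, R (N.tw (N.src d)) →
      d ∈ rem ∨ N.tw (N.src d) ∈ todo ∨ (σ.a .status (d / 2) = 0 → R (N.tw (N.dst d)))) ∧
    k = rem.length + (todo.map fun x => N.wt (N.tw x)).sum

/-- A step either makes progress in the scan, or finds that the scan is complete. -/
theorem pushStep_vc {N : Net} {C : Ctx} (hC : Setup N C) {R : ℕ → Prop} {σ₀ σ : Cfg} {k : ℕ}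
    (hS : Static N σ₀.a) (hR : ∀ x < 2 * N.n, σ₀.a .mark x = σ₀.v .stampA ↔ R x)
    (htail : σ₀.v .tailA ≤ 4 * N.n) (h : PushInv N R σ₀ σ k) (hdone : σ.v .done = 0) :
    pushStep.vc C (fun σ' =>
      (∃ k', PushInv N R σ₀ σ' k' ∧ k = k' + 1 ∧ σ'.v .done = 0) ∨
      (PushInv N R σ₀ σ' 0 ∧ σ'.v .done = 1)) σ := by
  have hn := N.two_le
  have hm := N.card
  have hlen := hC.len
  obtain ⟨hF, hQ, hP, todo, rem, h1, h2, h3, h4, h5, h6, h7⟩ := h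
  have hdst : σ.a .dst = σ₀.a .dst := hF.arr _ (by simp) (by simp)
  have heid : σ.a .eid = σ₀.a .eid := hF.arr _ (by simp) (by simp)
  have hnext : σ.a .next = σ₀.a .next := hF.arr _ (by simp) (by simp)
  have hhead : σ.a .head = σ₀.a .head := hF.arr _ (by simp) (by simp)
  have hmark : σ.a .mark = σ₀.a .mark := hF.arr _ (by simp) (by simp)
  have htA := hF.tailA
  have hpush := hQ.pushed_le
  simp only [pushStep, Cmd.block, Cmd.vc_ite, Cmd.vc_seq, Cmd.vc_rd, Cmd.vc_add, Cmd.vc_sub,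
    Cmd.vc_set, Cond.holds_eq, Cond.holds_lt, Opd.val_var, Opd.val_con, hC.zero, hC.one, hC.len]
  refine ⟨fun hp => ⟨fun hlt => ?_, fun hlt => ?_⟩, fun hp => ?_⟩
  -- The adjacency list is exhausted, and the other copy of the next node is taken.
  · rw [hp] at h4
    obtain rfl := h4.eq_nil
    cases todo with
    | nil => simp at h2; omega
    | cons x todo =>
      obtain ⟨hx, h1⟩ := h1
      obtain ⟨hx_lt, hRx⟩ := h3 x List.mem_cons_self
      refine ⟨by omega, by simp; omega, hC.vc_twin (by simpa [hx] using hx_lt) ?_⟩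
      have htw := Net.tw_lt hx_lt
      refine ⟨by simp [hx]; omega, .inl ⟨_, ⟨⟨?_, ?_, ?_, ?_, ?_⟩, ?_, ?_, todo, N.adj (N.tw x),
        ?_, ?_, ?_, ?_, ?_, ?_, rfl⟩, ?_, ?_⟩⟩
      · simpa using hF.arr
      · simpa using hF.popped
      · simpa using hF.stamp
      · simpa using hF.stampA
      · simpa using hF.tailA
      · simpa using hQ
      · simpa using hP
      · simpa using h1
      · simp at h2 ⊢; omega
      · exact fun y hy => h3 y (List.mem_cons_of_mem _ hy)
      · simpa [hx, hnext, hhead] using hS.adj _ htw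
      · intro d hd
        rw [Net.mem_adj] at hd
        rw [hd.2, Net.tw_tw hx_lt]
        exact ⟨hd.1, hRx⟩
      · intro d hd hRd
        rcases h6 d hd hRd with h | h | h
        · simp at h
        · rcases List.mem_cons.1 h with h | h
          · left
            rw [Net.mem_adj, ← h, Net.tw_tw (Net.src_lt hd)]
            exact ⟨hd, rfl⟩
          · exact .inr (.inl h)
        · exact .inr (.inr (by simpa using h))
      · rw [h7]; simp [Net.wt]; ring
      · simpa using hdone
  -- All nodes have been handled.
  · rw [hp] at h4
    obtain rfl := h4.eq_nil
    obtain rfl : todo = [] := List.eq_nil_of_length_eq_zero (by omega)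
    refine .inr ⟨⟨⟨?_, ?_, ?_, ?_, ?_⟩, ?_, ?_, [], [], ?_, ?_, ?_, ?_, ?_, ?_, by simp⟩, by simp⟩
    · simpa using hF.arr
    · simpa using hF.popped
    · simpa using hF.stamp
    · simpa using hF.stampA
    · simpa using hF.tailA
    · simpa using hQ
    · simpa using hP
    · simp [Seg]
    · simpa using h2
    · simp
    · simpa [Chain] using hp
    · simp
    · simpa using h6
  -- The next dart is scanned.
  · obtain ⟨rem, rfl, h4'⟩ := h4.exists_cons hp
    obtain ⟨hd, hRd⟩ := h5 _ List.mem_cons_self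
    have hd_dst : σ.a .dst (σ.v .ptr - 1) = N.dst (σ.v .ptr - 1) := by
      rw [hdst]; exact hS.dst _ hd
    have hd_eid : σ.a .eid (σ.v .ptr - 1) = (σ.v .ptr - 1) / 2 := by
      rw [heid]; exact hS.eid _ hd
    have hy := Net.dst_lt hd
    have hty := Net.tw_lt hy
    -- Nothing is done if the edge is not fresh or if the other copies are not separated.
    have hold : (σ.a .status ((σ.v .ptr - 1) / 2) = 0 → R (N.tw (N.dst (σ.v .ptr - 1)))) →
        ∀ σ' : Cfg, σ'.a = σ.a →
        (∀ x, x ≠ .dart → x ≠ .ptr → x ≠ .edge → x ≠ .tmp → x ≠ .nbr → x ≠ .twin →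
          σ'.v x = σ.v x) →
        σ'.v .ptr = σ.a .next (σ.v .ptr - 1) →
        ∃ k', PushInv N R σ₀ σ' k' ∧ k = k' + 1 ∧ σ'.v .done = 0 := by
      intro hor σ' ha hv hv'
      refine ⟨_, ⟨⟨?_, ?_, ?_, ?_, ?_⟩, ?_, ?_, todo, rem, ?_, ?_, h3, ?_, ?_, ?_, rfl⟩, ?_, ?_⟩
      · simpa [ha] using hF.arr
      · simpa [hv] using hF.popped
      · simpa [hv] using hF.stamp
      · simpa [hv] using hF.stampA
      · simpa [hv] using hF.tailA
      · simpa [ha, hv] using hQ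
      · simpa [ha] using hP
      · simpa [ha, hv] using h1
      · simpa [hv] using h2
      · simpa [ha, hv'] using h4'
      · exact fun d hd => h5 d (List.mem_cons_of_mem _ hd)
      · intro d hd hRd
        rw [ha]
        rcases h6 d hd hRd with h | h | h
        · rcases List.mem_cons.1 h with rfl | h
          · exact .inr (.inr hor)
          · exact .inl h
        · exact .inr (.inl h)
        · exact .inr (.inr h)
      · rw [h7]; simp; ring
      · simpa [hv] using hdone
    simp only [Cmd.vc_skip, Cfg.setV_v, Cfg.setV_a, reduceCtorEq, if_true, if_false, hd_dst, hd_eid]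
    refine ⟨by omega, by omega, by omega, fun hst => ⟨by omega, hC.vc_twin (by simpa using hy) ?_⟩,
      fun hst => ?_⟩
    · simp only [Cmd.vc_seq, Cmd.vc_rd, Cmd.vc_ite, Cmd.vc_add, Cond.holds_eq, Cmd.vc_skip,
        Cmd.vc_wr, Cfg.setV_v, Cfg.setV_a, Cfg.setA_v, reduceCtorEq, if_true, if_false,
        Opd.val_var, Opd.val_con, hC.one, hC.len]
      have hmk : σ.a .mark (N.tw (N.dst (σ.v .ptr - 1))) = σ.v .stampA ↔
          R (N.tw (N.dst (σ.v .ptr - 1))) := by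
        rw [hmark, hF.stampA]; exact hR _ hty
      refine ⟨by omega, fun hmk' => ?_, fun hmk' => ?_⟩
      · refine .inl (hold (fun _ => hmk.1 hmk') _ rfl ?_ ?_)
        · intro x h1 h2 h3 h4 h5 h6; simp [*]
        · simp
      -- Otherwise the edge is queued.
      · have he : (σ.v .ptr - 1) / 2 < N.m := by omega
        have hQ' := hQ.push he hst
        refine ⟨by omega, by omega, by omega, .inl ⟨_, ⟨⟨?_, ?_, ?_, ?_, ?_⟩, ?_, ?_, todo, rem,
          ?_, ?_, h3, ?_, ?_, ?_, rfl⟩, ?_, ?_⟩⟩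
        · intro j h1 h2; simpa [h1, h2] using hF.arr j h1 h2
        · simpa using hF.popped
        · simpa using hF.stamp
        · simpa using hF.stampA
        · simpa using hF.tailA
        · simpa using hQ'
        · intro f hf
          simp only [Cfg.setV_a, Cfg.setA_a, reduceCtorEq, if_true, if_false]
          obtain ⟨hf1, hf2⟩ := hP f hf
          by_cases hfe : f = (σ.v .ptr - 1) / 2
          · subst hfe
            rw [Function.update_self]
            refine ⟨fun hh => absurd ((hf1 hh).symm.trans hst) hh, fun _ => .inr ⟨rfl, ?_⟩⟩
            have hnot : ¬ R (N.tw (N.dst (σ.v .ptr - 1))) := fun hh => hmk' (hmk.2 hh)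
            unfold Net.src at hRd
            unfold Net.dst at hnot
            split at hRd
            · rw [if_pos (by assumption)] at hnot; tauto
            · rw [if_neg (by assumption)] at hnot; tauto
          · rw [Function.update_of_ne hfe]
            exact ⟨hf1, hf2⟩
        · simpa using h1
        · simpa using h2
        · simpa using h4'
        · exact fun d hd => h5 d (List.mem_cons_of_mem _ hd)
        · intro d hd hRd'
          simp only [Cfg.setV_a, Cfg.setA_a, reduceCtorEq, if_true, if_false]
          by_cases hde : d / 2 = (σ.v .ptr - 1) / 2
          · exact .inr (.inr (by simp [hde]))
          · rw [Function.update_of_ne hde]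
            rcases h6 d hd hRd' with h | h | h
            · rcases List.mem_cons.1 h with rfl | h
              · exact absurd rfl hde
              · exact .inl h
            · exact .inr (.inl h)
            · exact .inr (.inr h)
        · rw [h7]; simp; ring
        · simpa using hdone
    · refine .inl (hold (fun hh => absurd hh hst) _ rfl ?_ ?_)
      · intro x h1 h2 h3 h4 h5 h6; simp [*]
      · simp

theorem pushStep_cost : pushStep.cost = 21 := rfl

theorem pushLoop_wp {N : Net} {C : Ctx} (hC : Setup N C) {R : ℕ → Prop} {σ₀ σ : Cfg} {k : ℕ}
    (hS : Static N σ₀.a) (hR : ∀ x < 2 * N.n, σ₀.a .mark x = σ₀.v .stampA ↔ R x)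
    (htail : σ₀.v .tailA ≤ 4 * N.n) (h : PushInv N R σ₀ σ k) (hdone : σ.v .done = 0) :
    (Cmd.loop (.eq Var.done Con.zero) pushStep).wp C (fun σ' t =>
      PushInv N R σ₀ σ' 0 ∧ t ≤ 22 * k + 23) σ := by
  let I : Cfg → ℕ → Prop := fun σ' φ => ∃ k, PushInv N R σ₀ σ' k ∧
    (σ'.v .done = 0 ∧ φ = 22 * (k + 1) ∨ σ'.v .done = 1 ∧ k = 0)
  have key := Cmd.wp_loop (C := C) (b := .eq Var.done Con.zero) (p := pushStep) I ?_
    (σ := σ) (φ := 22 * (k + 1)) ⟨k, h, .inl ⟨hdone, rfl⟩⟩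
  · refine Cmd.wp_mono key ?_
    rintro σ' t ⟨hb, φ', ⟨k', hinv, hd⟩, ht⟩
    rcases hd with ⟨hd, _⟩ | ⟨_, rfl⟩
    · exact absurd (by simpa [hC.zero] using hd) hb
    · exact ⟨hinv, by omega⟩
  · rintro σ' φ ⟨k', hinv, hd⟩ hb
    rcases hd with ⟨hd, rfl⟩ | ⟨hd, _⟩
    · refine Cmd.wp_mono (Cmd.wp_of_vc (pushStep_vc hC hS hR htail hinv hd)) ?_
      rintro σ'' t ⟨ht, h'⟩
      rw [pushStep_cost] at ht
      rcases h' with ⟨k'', h1, rfl, h2⟩ | ⟨h1, h2⟩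
      · exact ⟨_, ⟨k'', h1, .inl ⟨h2, rfl⟩⟩, by omega⟩
      · exact ⟨0, ⟨0, h1, .inr ⟨h2, rfl⟩⟩, by omega⟩
    · simp [hC.zero, hd] at hb

/-! ### Splitting a component -/

/-- The effect of a split: `r` is the end in the lighter component. An edge is only queued if
exactly one of the other copies of its endpoints is in this component, and no such edge stays
fresh. -/
structure SplitPost (N : Net) (σ σ' : Cfg) (r r' : ℕ) : Prop where
  ends : r = σ.v .endA ∧ r' = σ.v .endB ∨ r = σ.v .endB ∧ r' = σ.v .endA
  le : N.compWt (σ.a .status · ≠ 2) r ≤ N.compWt (σ.a .status · ≠ 2) r'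
  static : Static N σ'.a
  mark_le : ∀ x < 2 * N.n, σ'.a .mark x ≤ σ'.v .stamp
  stamp : σ'.v .stamp = σ.v .stamp + 2
  popped : σ'.v .popped = σ.v .popped
  queue : Queue N.m (σ'.a .status) (σ'.a .del) (σ'.v .popped) (σ'.v .pushed)
  pushed : Pushed N ((N.gr (σ.a .status · ≠ 2)).Reachable r) (σ.a .status) (σ'.a .status)
  fresh : ∀ e < N.m, σ'.a .status e = 0 →
    ((N.gr (σ.a .status · ≠ 2)).Reachable r (N.tw (N.X e)) ↔
      (N.gr (σ.a .status · ≠ 2)).Reachable r (N.tw (N.Y e)))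

theorem Static.congr {N : Net} {a a' : Arr → ℕ → ℕ} (h : Static N a) (hd : a' .dst = a .dst)
    (he : a' .eid = a .eid) (hn : a' .next = a .next) (hh : a' .head = a .head) :
    Static N a' where
  dst := by rw [hd]; exact h.dst
  eid := by rw [he]; exact h.eid
  adj := by rw [hn, hh]; exact h.adj

/-- The cost of a split is proportional to the charge of the lighter component. -/
theorem splitCmd_wp {N : Net} {C : Ctx} (hC : Setup N C) {σ : Cfg} (h : SplitPre N σ) :
    splitCmd.wp C (fun σ' t => ∃ r r', SplitPost N σ σ' r r' ∧
      t ≤ 120 + 70 * ∑ x ∈ N.comp (σ.a .status · ≠ 2) r, N.charge x) σ := by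
  refine Cmd.wp_seq (Cmd.wp_mono (Cmd.wp_of_vc (exploreInit_vc hC h)) ?_)
  rintro σ₁ t₁ ⟨ht₁, h₁, hd₁⟩
  refine Cmd.wp_seq (Cmd.wp_mono (exploreLoop_wp hC h.static h₁ hd₁) ?_)
  rintro σ₂ t₂ ⟨r, r', a, b, hor, h₂, hab, hp, hht, ht₂⟩
  have hst : σ₂.a .status = σ.a .status := h₂.frame.arr _ (by simp) (by simp)
  have hA : Side N _ _ _ _ _ _ _ _ _ _ _ := h₂.sideA
  have hB : Side N _ _ _ _ _ _ _ _ _ _ _ := h₂.sideB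
  have hb := hB.work_le
  have htail := hA.tail_le
  rw [hp] at hA
  obtain ⟨ha, hmk, vis, hvis1, hvis2, hvis3, hvis4⟩ := hA.complete hht
  rw [hst] at ha hmk hvis4 hb
  set R : ℕ → Prop := (N.gr (σ.a .status · ≠ 2)).Reachable r with hR
  have hr_lt : r < 2 * N.n := hA.root_lt
  have hmem : ∀ x, x ∈ vis ↔ R x := by
    intro x
    rw [← List.mem_toFinset, hvis4, Net.mem_comp hr_lt]
  have hS₂ : Static N σ₂.a := h.static.congr (h₂.frame.arr _ (by simp) (by simp))
    (h₂.frame.arr _ (by simp) (by simp)) (h₂.frame.arr _ (by simp) (by simp))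
    (h₂.frame.arr _ (by simp) (by simp))
  have hstart := h₂.start
  have hpushInit : pushInit.vc C (fun σ' =>
      PushInv N R σ₂ σ' (vis.map fun x => N.wt (N.tw x)).sum ∧ σ'.v .done = 0) σ₂ := by
    simp only [pushInit, Cmd.block, Cmd.vc_seq, Cmd.vc_set, Opd.val_var, Opd.val_con, hC.zero]
    refine ⟨⟨⟨?_, ?_, ?_, ?_, ?_⟩, ?_, ?_, vis, [], ?_, ?_, ?_, ?_, ?_, ?_, ?_⟩, ?_⟩
    · simp
    · simp
    · simp
    · simp
    · simp
    · have := h.queue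
      rw [← h₂.frame.popped, ← h₂.frame.pushed, ← hst, ← h₂.frame.arr .del (by simp) (by simp)]
        at this
      simpa using this
    · intro e _
      exact ⟨fun _ => rfl, fun h => .inl h⟩
    · simpa using hvis2
    · simpa using hvis1
    · intro x hx
      rw [hmem] at hx
      exact ⟨Net.lt_of_reachable hx hr_lt, hx⟩
    · simp [Chain]
    · simp
    · intro d _ hd
      exact .inr (.inl ((hmem _).2 hd))
    · simp
    · simp
  refine Cmd.wp_seq (Cmd.wp_mono (Cmd.wp_of_vc hpushInit) ?_)
  rintro σ₃ t₃ ⟨ht₃, h₃, hd₃⟩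
  refine Cmd.wp_mono (pushLoop_wp hC hS₂ hmk (by omega) h₃ hd₃) ?_
  rintro σ₄ t₄ ⟨⟨hF, hQ, hP, todo, rem, _, _, _, _, _, h6, h7⟩, ht₄⟩
  obtain rfl : rem = [] := List.eq_nil_of_length_eq_zero (by omega)
  obtain rfl : todo = [] := by
    cases todo with
    | nil => rfl
    | cons x l => simp [Net.wt] at h7; omega
  refine ⟨r, r', ⟨hor, ha ▸ hab.trans hb, ?_, ?_, ?_, ?_, hQ, ?_, ?_⟩, ?_⟩
  · exact hS₂.congr (hF.arr _ (by simp) (by simp)) (hF.arr _ (by simp) (by simp))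
      (hF.arr _ (by simp) (by simp)) (hF.arr _ (by simp) (by simp))
  · rw [hF.arr .mark (by simp) (by simp), hF.stamp]
    exact h₂.mark_le
  · rw [hF.stamp, h₂.frame.stamp]
  · rw [hF.popped, h₂.frame.popped]
  · rwa [hst] at hP
  · intro e he hst'
    -- The edge was checked from both ends, as the darts `2 e` and `2 e + 1`.
    have e1 : 2 * e / 2 = e := by omega
    have e2 : (2 * e + 1) / 2 = e := by omega
    have e3 : (2 * e + 1) % 2 = 1 := by omega
    have hd1 := h6 (2 * e) (by omega)
    have hd2 := h6 (2 * e + 1) (by omega)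
    simp only [Net.src, Net.dst, e1, e2, e3, Nat.mul_mod_right, List.not_mem_nil, false_or,
      hst', if_true, one_ne_zero, if_false, forall_const] at hd1 hd2
    exact ⟨hd1, hd2⟩
  · have hc : ∑ x ∈ N.comp (σ.a .status · ≠ 2) r, N.charge x =
        a + (vis.map fun x => N.wt (N.tw x)).sum := by
      simp only [Net.charge, Finset.sum_add_distrib]
      rw [ha, Net.compWt, ← hvis4, ← List.sum_toFinset _ hvis3]
    have c1 : exploreInit.cost = 20 := rfl
    have c2 : pushInit.cost = 3 := rfl
    rw [hc]
    omega

end LamanRAM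

/-! ### The main loop -/
namespace LamanRAM

/-- The nodes `0` and `n` are the two copies of the vertex `0`. The condition says that in the
beginning they lie in different trees, and that splitting off the lighter one of these trees
reveals all separated pairs of nodes that are copies of adjacent vertices. -/
structure Net.Start (N : Net) : Prop where
  not_reachable : ¬ (N.gr fun _ => True).Reachable 0 N.n
  fresh : ∀ r r', (r = 0 ∧ r' = N.n ∨ r = N.n ∧ r' = 0) →
    N.compWt (fun _ => True) r ≤ N.compWt (fun _ => True) r' →
    ∀ e < N.m, ((N.gr fun _ => True).Reachable r (N.tw (N.X e)) ↔
      (N.gr fun _ => True).Reachable r (N.tw (N.Y e))) →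
    (N.gr fun _ => True).Reachable (N.tw (N.X e)) (N.tw (N.Y e))

/-- The invariant of the main loop. The other copies of the endpoints of a fresh edge are connected
by edges that are not deleted, and all edges of supported sets are fresh. -/
structure MainInv (N : Net) (σ : Cfg) : Prop where
  static : Static N σ.a
  mark_le : ∀ x < 2 * N.n, σ.a .mark x ≤ σ.v .stamp
  stamp : σ.v .stamp = 2 * σ.v .popped + 2
  queue : Queue N.m (σ.a .status) (σ.a .del) (σ.v .popped) (σ.v .pushed)
  fresh : ∀ e < N.m, σ.a .status e = 0 →
    (N.gr (σ.a .status · ≠ 2)).Reachable (N.tw (N.X e)) (N.tw (N.Y e))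
  supported : ∀ Z, N.Supported Z → ∀ e ∈ Z, σ.a .status e = 0

/-- A split only queues edges, it does not delete any. -/
theorem Pushed.alive_iff {N : Net} {R : ℕ → Prop} {st st' : ℕ → ℕ} (h : Pushed N R st st') :
    ∀ e < N.m, st e ≠ 2 ↔ st' e ≠ 2 := by
  intro e he
  obtain ⟨h1, h2⟩ := h e he
  by_cases h0 : st e = 0
  · rcases h2 h0 with h | ⟨h, _⟩ <;> simp [h0, h]
  · rw [h1 h0]

theorem Pushed.fresh_of_fresh {N : Net} {R : ℕ → Prop} {st st' : ℕ → ℕ} (h : Pushed N R st st')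
    {e : ℕ} (he : e < N.m) (h' : st' e = 0) : st e = 0 := by
  by_contra h0
  exact h0 (((h e he).1 h0).symm.trans h')

/-- Edges of supported sets are never queued. -/
theorem Pushed.supported {N : Net} {st st' : ℕ → ℕ} {r : ℕ}
    (h : Pushed N ((N.gr (st · ≠ 2)).Reachable r) st st') {Z : Set ℕ} (hZ : N.Supported Z)
    (h0 : ∀ e ∈ Z, st e = 0) : ∀ e ∈ Z, st' e = 0 := by
  intro e he
  refine (((h e (hZ e he).1).2 (h0 e he)).resolve_right fun h1 => h1.2 ?_)
  have hreach := hZ.reachable (P := (st · ≠ 2)) (fun f hf => by rw [h0 f hf]; norm_num) he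
  exact ⟨fun h => h.trans hreach, fun h => h.trans hreach.symm⟩

theorem popCmd_vc {N : Net} {C : Ctx} (hC : Setup N C) {σ : Cfg} (h : MainInv N σ)
    (hlt : σ.v .popped < σ.v .pushed) :
    popCmd.vc C (fun σ' => SplitPre N σ' ∧
      σ'.a .status = Function.update (σ.a .status) (σ.a .del (σ.v .popped)) 2 ∧
      σ'.v .endA = N.X (σ.a .del (σ.v .popped)) ∧ σ'.v .endB = N.Y (σ.a .del (σ.v .popped)) ∧
      σ'.v .popped = σ.v .popped + 1 ∧ σ'.v .stamp = σ.v .stamp) σ := by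
  have hm := N.card
  have hQ := h.queue
  have hpush := hQ.pushed_le
  have he := hQ.lt _ hlt
  have hst := h.stamp
  simp only [popCmd, Cmd.block, Cmd.vc_seq, Cmd.vc_rd, Cmd.vc_add, Cmd.vc_wr, Opd.val_var,
    Opd.val_con, hC.one, hC.two, hC.len, Cfg.setV_v, Cfg.setV_a, Cfg.setA_v, Cfg.setA_a,
    reduceCtorEq, if_true, if_false]
  set e := σ.a .del (σ.v .popped) with he_def
  have hd1 : σ.a .dst (e + e) = N.Y e := by
    rw [h.static.dst _ (by omega), Net.dst, if_pos (by omega)]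
    congr 1; omega
  have hd2 : σ.a .dst (e + e + 1) = N.X e := by
    rw [h.static.dst _ (by omega), Net.dst, if_neg (by omega)]
    congr 1; omega
  rw [hd1, hd2]
  refine ⟨by omega, by omega, by omega, by omega, by omega, by omega, by omega,
    ⟨?_, ?_, ?_, ?_, ?_, ?_, ?_⟩, ?_, ?_, ?_, ?_, ?_⟩
  · exact h.static.congr (by simp) (by simp) (by simp) (by simp)
  · simpa using h.mark_le
  · simp; omega
  · simpa [← he_def] using hQ.pop hlt
  · simpa using N.X_lt e he
  · simpa using N.Y_lt e he
  · simp only [Cfg.setV_v, Cfg.setV_a, Cfg.setA_a, reduceCtorEq, if_true, if_false]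
    exact Net.not_reachable_of_not he (by simp)
  all_goals simp

theorem popCmd_cost : popCmd.cost = 11 := rfl

/-- The cost of the deletion of an edge is covered by the loss of potential. -/
theorem mainStep_wp {N : Net} {C : Ctx} (hC : Setup N C) {σ : Cfg} (h : MainInv N σ)
    (hlt : σ.v .popped < σ.v .pushed) :
    (Cmd.seq popCmd splitCmd).wp C (fun σ' t => MainInv N σ' ∧ σ'.v .popped = σ.v .popped + 1 ∧
      t + 70 * N.pot (σ'.a .status · ≠ 2) ≤ 131 + 70 * N.pot (σ.a .status · ≠ 2)) σ := by
  refine Cmd.wp_seq (Cmd.wp_mono (Cmd.wp_of_vc (popCmd_vc hC h hlt)) ?_)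
  rintro σ₁ t₁ ⟨ht₁, hpre, hst, hA, hB, hpop, hstamp⟩
  refine Cmd.wp_mono (splitCmd_wp hC hpre) ?_
  rintro σ₂ t₂ ⟨r, r', hpost, ht₂⟩
  have hQ := h.queue
  set e := σ.a .del (σ.v .popped) with he_def
  have he : e < N.m := hQ.lt _ hlt
  have hst_e : σ.a .status e = 1 := by rw [hQ.status _ hlt]; simp
  have hends := hpost.ends
  rw [hA, hB] at hends
  have hst_of_ne : ∀ f, f ≠ e → σ₁.a .status f = σ.a .status f := fun f hf => by
    rw [hst, Function.update_of_ne hf]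
  have hst₁_e : σ₁.a .status e = 2 := by rw [hst, Function.update_self]
  have hpot := Net.pot_delete (P := (σ.a .status · ≠ 2)) (P' := (σ₁.a .status · ≠ 2)) he
    (by simp [hst_e]) (by simp [hst₁_e])
    (fun f hf => by
      rwa [hst_of_ne f (by rintro rfl; exact hf hst₁_e)] at hf) hends hpost.le
  have halive := hpost.pushed.alive_iff
  rw [Net.pot_congr halive] at hpot
  refine ⟨⟨hpost.static, hpost.mark_le, ?_, hpost.queue, ?_, ?_⟩, ?_, ?_⟩
  · rw [hpost.stamp, hpost.popped, hpop, hstamp, h.stamp]; ring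
  · intro f hf hf0
    rw [← Net.gr_congr halive]
    have hf1 := hpost.pushed.fresh_of_fresh hf hf0
    have hfe : f ≠ e := by rintro rfl; omega
    -- A path between the other copies that uses `e` would have exactly one end in the lighter part.
    have hreach := h.fresh f hf (by rw [← hst_of_ne f hfe]; exact hf1)
    have hiff := hpost.fresh f hf hf0
    rcases Net.reachable_delete (P' := (σ₁.a .status · ≠ 2)) (e := e)
      (fun g hg hge => by rwa [hst_of_ne g hge]) hreach with h1 | ⟨h1, h2⟩ | ⟨h1, h2⟩
    · exact h1
    · rcases hends with ⟨rfl, rfl⟩ | ⟨rfl, rfl⟩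
      · exact h1.trans (hiff.1 h1.symm)
      · exact (hiff.2 h2).symm.trans h2
    · rcases hends with ⟨rfl, rfl⟩ | ⟨rfl, rfl⟩
      · exact (hiff.2 h2).symm.trans h2
      · exact h1.trans (hiff.1 h1.symm)
  · intro Z hZ
    refine hpost.pushed.supported hZ fun f hf => ?_
    have hf0 := h.supported Z hZ f hf
    rw [hst_of_ne f (by rintro rfl; omega), hf0]
  · rw [hpost.popped, hpop]
  · rw [popCmd_cost] at ht₁
    omega

/-- The configuration in which the data of the forest have been set up. -/
structure Ready (N : Net) (σ : Cfg) : Prop where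
  static : Static N σ.a
  status : σ.a .status = fun _ => 0
  mark : σ.a .mark = fun _ => 0
  stamp : σ.v .stamp = 0
  popped : σ.v .popped = 0
  pushed : σ.v .pushed = 0

/-- The edges that stay fresh form the greatest supported set. -/
theorem pruneCmd_wp {N : Net} {C : Ctx} (hC : Setup N C) (hN : N.Start) {σ : Cfg}
    (h : Ready N σ) :
    pruneCmd.wp C (fun σ' t => (σ'.v .out = 1 ↔ ∀ Z, N.Supported Z → Z = ∅) ∧
      (σ'.v .out = 0 ↔ ¬ ∀ Z, N.Supported Z → Z = ∅) ∧ t ≤ 6000 * (N.n * Nat.log 2 N.n)) σ := by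
  have hn := N.two_le
  have hm := N.card
  have halive : ∀ e < N.m, σ.a .status e ≠ 2 ↔ True := by simp [h.status]
  -- The two assignments before the first split are executed one by one.
  refine Cmd.wp_seq (Cmd.wp_mono (Cmd.wp_of_vc (Q := fun σ' => σ' = σ.setV .endA 0)
    (by simp [hC.zero])) ?_)
  rintro _ t₁ ⟨ht₁, rfl⟩
  refine Cmd.wp_seq (Cmd.wp_mono (Cmd.wp_of_vc
    (Q := fun σ' => σ' = (σ.setV .endA 0).setV .endB N.n) (by simp [hC.verts])) ?_)
  rintro _ t₂ ⟨ht₂, rfl⟩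
  set σ₁ := (σ.setV .endA 0).setV .endB N.n with hσ₁
  have hpre : SplitPre N σ₁ := by
    refine ⟨?_, ?_, ?_, ?_, ?_, ?_, ?_⟩
    · simpa [hσ₁] using h.static
    · simp [hσ₁, h.mark]
    · simp [hσ₁, h.stamp]; omega
    · simpa [hσ₁, h.status, h.popped, h.pushed] using Queue.empty
    · simp [hσ₁]; omega
    · simp [hσ₁]; omega
    · have := hN.not_reachable
      rw [← Net.gr_congr halive] at this
      simpa [hσ₁] using this
  refine Cmd.wp_seq (Cmd.wp_mono (splitCmd_wp hC hpre) ?_)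
  rintro σ₂ t₃ ⟨r, r', hpost, ht₃⟩
  have halive₁ : ∀ e < N.m, σ₁.a .status e ≠ 2 ↔ True := halive
  have halive₂ := hpost.pushed.alive_iff
  have hinv : MainInv N σ₂ := by
    refine ⟨hpost.static, hpost.mark_le, ?_, hpost.queue, ?_, ?_⟩
    · rw [hpost.stamp, hpost.popped]
      simp [hσ₁, h.stamp, h.popped]
    · intro e he he0
      rw [← Net.gr_congr halive₂, Net.gr_congr halive₁]
      have hiff := hpost.fresh e he he0
      have hle := hpost.le
      rw [Net.gr_congr halive₁] at hiff
      rw [Net.compWt_congr halive₁] at hle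
      refine hN.fresh r r' ?_ hle e he hiff
      simpa [hσ₁] using hpost.ends
    · intro Z hZ
      exact hpost.pushed.supported hZ fun e _ => by simp [hσ₁, h.status]
  have hpopped₂ : σ₂.v .popped = 0 := by rw [hpost.popped]; simp [hσ₁, h.popped]
  let I : Cfg → ℕ → Prop := fun σ φ => MainInv N σ ∧
    φ = 132 * (N.m - σ.v .popped) + 70 * N.pot (σ.a .status · ≠ 2)
  have key := Cmd.wp_loop (C := C) (b := .lt Var.popped Var.pushed)
    (p := .seq popCmd splitCmd) I ?_ (σ := σ₂) ⟨hinv, rfl⟩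
  · refine Cmd.wp_seq (Cmd.wp_mono key ?_)
    rintro σ₃ t₄ ⟨hb, φ, ⟨hinv₃, hφ⟩, ht₄⟩
    simp only [Cond.holds_lt, Opd.val_var] at hb
    have hQ := hinv₃.queue
    -- The queue is empty, so the fresh edges are the edges that are not deleted.
    have hfresh : ∀ e < N.m, σ₃.a .status e ≠ 2 ↔ e ∈ {e | e < N.m ∧ σ₃.a .status e = 0} := by
      intro e he
      simp only [Set.mem_ofPred_eq, he, true_and]
      refine ⟨fun h2 => ?_, fun h0 => by omega⟩
      by_contra h0
      obtain ⟨i, hi, rfl⟩ := hQ.surj e he h0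
      rw [hQ.status i hi, if_pos (by omega)] at h2
      exact h2 rfl
    have hanswer : σ₃.v .pushed = N.m ↔ ∀ Z, N.Supported Z → Z = ∅ := by
      rw [hQ.pushed_eq_iff]
      constructor
      · intro hall Z hZ
        refine Set.eq_empty_of_forall_notMem fun e he => ?_
        exact hall e (hZ e he).1 (hinv₃.supported Z hZ e he)
      · intro hall e he he0
        have hZ : N.Supported {e | e < N.m ∧ σ₃.a .status e = 0} := by
          rintro f ⟨hf, hf0⟩
          refine ⟨hf, ?_⟩
          rw [← Net.gr_congr hfresh]
          exact hinv₃.fresh f hf hf0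
        have : e ∈ {e | e < N.m ∧ σ₃.a .status e = 0} := ⟨he, he0⟩
        rw [hall _ hZ] at this
        exact this
    refine Cmd.wp_mono (Cmd.wp_of_vc (Q := fun σ' =>
      (σ'.v .out = 1 ↔ ∀ Z, N.Supported Z → Z = ∅) ∧
      (σ'.v .out = 0 ↔ ¬ ∀ Z, N.Supported Z → Z = ∅)) ?_) ?_
    · rw [← hanswer]
      simp only [Cmd.block, Cmd.vc_ite, Cmd.vc_set, Cond.holds_eq, Opd.val_var, Opd.val_con,
        hC.edges, hC.one, hC.zero, Cfg.setV_v, if_true]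
      refine ⟨fun hh => ?_, fun hh => ?_⟩ <;> simp [hh]
    · rintro σ₄ t₅ ⟨ht₅, ho1, ho0⟩
      refine ⟨ho1, ho0, ?_⟩
      have hch : ∑ x ∈ N.comp (σ₁.a .status · ≠ 2) r, N.charge x ≤ 4 * N.n + 4 * N.m := by
        rw [← Net.sum_charge]
        exact Finset.sum_le_sum_of_subset Net.comp_subset
      have hpot := Net.pot_le (N := N) (P := (σ₂.a .status · ≠ 2))
      change t₁ ≤ 1 at ht₁
      change t₂ ≤ 1 at ht₂
      change t₅ ≤ 2 at ht₅
      -- The first split costs at most `120 + 70 * 12 n`, the loop `132 m + 70 * 48 n log n`.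
      have hlog : N.n * 1 ≤ N.n * Nat.log 2 N.n :=
        Nat.mul_le_mul_left _ (Nat.log_pos (by norm_num) hn)
      rw [hpopped₂] at ht₄
      omega
  · rintro σ' φ ⟨hinv', rfl⟩ hb
    simp only [Cond.holds_lt, Opd.val_var] at hb
    refine Cmd.wp_mono (mainStep_wp hC hinv' hb) ?_
    rintro σ'' t ⟨h1, h2, h3⟩
    have := hinv'.queue.pushed_le
    exact ⟨_, ⟨h1, rfl⟩, by omega⟩

end LamanRAM

/-! ### Reading the input -/
namespace LamanRAM

/-- Add the dart number `dart` from `x` to `y` to the adjacency lists. -/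
def addDart (x y : Var) : Cmd := .block [
  .wr .dst Var.dart y, .wr .eid Var.dart Var.edge, .rd .tmp .head x,
  .wr .next Var.dart Var.tmp, .add .dart Var.dart Con.one, .wr .head x Var.dart]

/-- Read the next edge from the input. -/
def buildStep : Cmd := .block [
  .rd .node .input Var.pos, .add .pos Var.pos Con.one,
  .rd .nbr .input Var.pos, .add .pos Var.pos Con.one,
  .ite (.lt Var.edge Con.firstLen) .skip
    (.block [.add .node Var.node Con.verts, .add .nbr Var.nbr Con.verts]),
  addDart .node .nbr, addDart .nbr .node, .add .edge Var.edge Con.one]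

/-- Read the input and construct the adjacency lists. -/
def buildCmd : Cmd := .block [
  .add .pos Con.two Con.one, .set .edge Con.zero, .set .dart Con.zero,
  .loop (.lt Var.edge Con.edges) buildStep]

/-- The arrays contain the darts below `k`. -/
structure Built (N : Net) (a : Arr → ℕ → ℕ) (k : ℕ) : Prop where
  dst : ∀ d < k, a .dst d = N.dst d
  eid : ∀ d < k, a .eid d = d / 2
  adj : ∀ x < 2 * N.n, Chain (a .next) (a .head x) (N.adjUpTo k x)

theorem addDart_vc {N : Net} {C : Ctx} (hC : Setup N C) {x y : Var} {σ : Cfg} {k : ℕ}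
    (hx : x ≠ .tmp ∧ x ≠ .dart) (hk : k < 2 * N.m) (h : Built N σ.a k) (hd : σ.v .dart = k)
    (he : σ.v .edge = k / 2) (hvx : σ.v x = N.src k) (hvy : σ.v y = N.dst k) {Q : Cfg → Prop}
    (hQ : ∀ σ' : Cfg, Built N σ'.a (k + 1) → σ'.v .dart = k + 1 →
      (∀ z, z ≠ .tmp → z ≠ .dart → σ'.v z = σ.v z) →
      (∀ j, j ≠ .dst → j ≠ .eid → j ≠ .next → j ≠ .head → σ'.a j = σ.a j) → Q σ') :
    (addDart x y).vc C Q σ := by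
  have hm := N.card
  have hsrc := Net.src_lt hk
  simp only [addDart, Cmd.block, Cmd.vc_seq, Cmd.vc_wr, Cmd.vc_rd, Cmd.vc_add, Opd.val_var,
    Opd.val_con, hC.one, hC.len, Cfg.setV_v, Cfg.setA_v, Cfg.setA_a, reduceCtorEq,
    if_true, if_false, hx.1, hx.2, hd, he, hvx, hvy]
  refine ⟨by omega, by omega, by omega, by omega, by omega, by omega, hQ _ ⟨?_, ?_, ?_⟩ ?_ ?_ ?_⟩
  · intro d hd'
    simp only [Cfg.setV_a, Cfg.setA_a, reduceCtorEq, if_true, if_false]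
    by_cases hdk : d = k
    · simp [hdk]
    · rw [Function.update_of_ne hdk, h.dst d (by omega)]
  · intro d hd'
    simp only [Cfg.setV_a, Cfg.setA_a, reduceCtorEq, if_true, if_false]
    by_cases hdk : d = k
    · simp [hdk]
    · rw [Function.update_of_ne hdk, h.eid d (by omega)]
  · intro z hz
    simp only [Cfg.setV_a, Cfg.setA_a, reduceCtorEq, if_true, if_false]
    have hch : Chain (Function.update (σ.a .next) k (σ.a .head (N.src k))) (σ.a .head z)
        (N.adjUpTo k z) :=
      (h.adj z hz).update fun hh => absurd (Net.mem_adjUpTo.1 hh).1 (lt_irrefl _)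
    unfold Net.adjUpTo
    by_cases hzx : N.src k = z
    · subst hzx
      rw [if_pos rfl, Function.update_self]
      exact ⟨rfl, by rw [Function.update_self]; exact hch⟩
    · rw [if_neg hzx, Function.update_of_ne (Ne.symm hzx)]
      exact hch
  · simp
  · intro z h1 h2; simp [h1, h2]
  · intro j h1 h2 h3 h4; simp [h1, h2, h3, h4]

/-- The words of the input describe the edges of `N`: the endpoints of the edges of the second
forest have to be shifted by `n`. -/
def Describes (N : Net) (firstLen : ℕ) (words : ℕ → ℕ) : Prop :=
  ∀ e < N.m, words (3 + 2 * e) + (if e < firstLen then 0 else N.n) = N.X e ∧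
    words (4 + 2 * e) + (if e < firstLen then 0 else N.n) = N.Y e

/-- The invariant of the loop that reads the input, when `e` edges have been read. -/
structure BuildInv (N : Net) (σ₀ σ : Cfg) (e : ℕ) : Prop where
  le : e ≤ N.m
  built : Built N σ.a (2 * e)
  edge : σ.v .edge = e
  dart : σ.v .dart = 2 * e
  pos : σ.v .pos = 3 + 2 * e
  arr : ∀ j, j ≠ .dst → j ≠ .eid → j ≠ .next → j ≠ .head → σ.a j = σ₀.a j
  stamp : σ.v .stamp = σ₀.v .stamp
  popped : σ.v .popped = σ₀.v .popped
  pushed : σ.v .pushed = σ₀.v .pushed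

theorem buildStep_vc {N : Net} {C : Ctx} (hC : Setup N C) {σ₀ σ : Cfg} {e : ℕ}
    (hw : Describes N (C.con .firstLen) (σ₀.a .input)) (h : BuildInv N σ₀ σ e) (he : e < N.m) :
    buildStep.vc C (fun σ' => BuildInv N σ₀ σ' (e + 1)) σ := by
  have hm := N.card
  have hX := N.X_lt e he
  have hY := N.Y_lt e he
  obtain ⟨hw1, hw2⟩ := hw e he
  have hin : σ.a .input = σ₀.a .input := h.arr _ (by simp) (by simp) (by simp) (by simp)
  have hpos := h.pos
  have hpos' : 3 + 2 * e + 1 = 4 + 2 * e := by ring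
  have hsrc : N.src (2 * e) = N.X e := by simp [Net.src]
  have hdst : N.dst (2 * e) = N.Y e := by simp [Net.dst]
  have e2 : (2 * e + 1) / 2 = e := by omega
  have e3 : (2 * e + 1) % 2 = 1 := by omega
  have hsrc' : N.src (2 * e + 1) = N.Y e := by simp [Net.src, e2, e3]
  have hdst' : N.dst (2 * e + 1) = N.X e := by simp [Net.dst, e2, e3]
  -- After the two endpoints have been computed, the two darts are added.
  have key : ∀ σ₁ : Cfg, σ₁.a = σ.a → σ₁.v .node = N.X e → σ₁.v .nbr = N.Y e →
      σ₁.v .pos = 5 + 2 * e → (∀ z, z ≠ .node → z ≠ .nbr → z ≠ .pos → σ₁.v z = σ.v z) →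
      (addDart .node .nbr).vc C ((addDart .nbr .node).vc C
        ((Cmd.add .edge Var.edge Con.one).vc C fun σ' => BuildInv N σ₀ σ' (e + 1))) σ₁ := by
    intro σ₁ ha h1 h2 h3 hv
    refine addDart_vc hC (k := 2 * e) (by simp) (by omega) (by rw [ha]; exact h.built)
      (by rw [hv _ (by simp) (by simp) (by simp), h.dart])
      (by rw [hv _ (by simp) (by simp) (by simp), h.edge]; omega) (by rw [h1, hsrc])
      (by rw [h2, hdst]) ?_
    intro σ₂ hB₂ hd₂ hv₂ ha₂
    have hedge₂ : σ₂.v .edge = e := by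
      rw [hv₂ _ (by simp) (by simp), hv _ (by simp) (by simp) (by simp), h.edge]
    refine addDart_vc hC (k := 2 * e + 1) (by simp) (by omega) hB₂ hd₂ (by rw [hedge₂, e2])
      (by rw [hv₂ _ (by simp) (by simp), h2, hsrc'])
      (by rw [hv₂ _ (by simp) (by simp), h1, hdst']) ?_
    intro σ₃ hB₃ hd₃ hv₃ ha₃
    have hedge₃ : σ₃.v .edge = e := by rw [hv₃ _ (by simp) (by simp), hedge₂]
    have hrest : ∀ z, z ≠ .tmp → z ≠ .dart → z ≠ .node → z ≠ .nbr → z ≠ .pos →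
        σ₃.v z = σ.v z := fun z h1 h2 h3 h4 h5 => by
      rw [hv₃ z h1 h2, hv₂ z h1 h2, hv z h3 h4 h5]
    simp only [Cmd.vc_add, Opd.val_var, Opd.val_con, hC.one, hC.len, hedge₃]
    refine ⟨by omega, by omega, by simpa [mul_add] using hB₃, by simp, by simp [hd₃]; ring,
      ?_, ?_, ?_, ?_, ?_⟩
    · simp [hv₃, hv₂, h3]; ring
    · intro j h1 h2 h3 h4
      rw [Cfg.setV_a, ha₃ j h1 h2 h3 h4, ha₂ j h1 h2 h3 h4, ha, h.arr j h1 h2 h3 h4]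
    · simpa [hrest] using h.stamp
    · simpa [hrest] using h.popped
    · simpa [hrest] using h.pushed
  simp only [buildStep, Cmd.block, Cmd.vc_seq, Cmd.vc_rd, Cmd.vc_ite, Cmd.vc_skip, Opd.val_var,
    Opd.val_con, Cond.holds_lt, Cmd.vc_add, hC.one, hC.len, hC.verts, Cfg.setV_v, Cfg.setV_a,
    reduceCtorEq, if_true, if_false, hpos, h.edge, hin, hpos'] at key ⊢
  refine ⟨by omega, by omega, by omega, by omega, fun hlt => ?_, fun hlt => ?_⟩
  · rw [if_pos hlt, add_zero] at hw1 hw2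
    refine key _ (by simp) (by simpa using hw1) (by simpa using hw2) (by simp; ring) ?_
    intro z h1 h2 h3; simp [h1, h2, h3]
  · rw [if_neg hlt] at hw1 hw2
    refine ⟨by omega, by omega, ?_⟩
    refine key _ (by simp) (by simpa using hw1) (by simpa using hw2) (by simp; ring) ?_
    intro z h1 h2 h3; simp [h1, h2, h3]

theorem buildStep_cost : buildStep.cost = 32 := rfl

theorem buildCmd_wp {N : Net} {C : Ctx} (hC : Setup N C) (hCe : C.con .edges = N.m) {σ : Cfg}
    (hw : Describes N (C.con .firstLen) (σ.a .input)) (hv : ∀ x, σ.v x = 0)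
    (ha : ∀ j, j ≠ .input → σ.a j = fun _ => 0) :
    buildCmd.wp C (fun σ' t => Ready N σ' ∧ t ≤ 70 * N.n) σ := by
  have hm := N.card
  have hn := N.two_le
  refine Cmd.wp_seq (Cmd.wp_mono (Cmd.wp_of_vc (Q := fun σ' => σ' = σ.setV .pos 3)
    (by simp [hC.two, hC.one, hC.len]; omega)) ?_)
  rintro _ t₁ ⟨ht₁, rfl⟩
  refine Cmd.wp_seq (Cmd.wp_mono (Cmd.wp_of_vc
    (Q := fun σ' => σ' = (σ.setV .pos 3).setV .edge 0) (by simp [hC.zero])) ?_)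
  rintro _ t₂ ⟨ht₂, rfl⟩
  refine Cmd.wp_seq (Cmd.wp_mono (Cmd.wp_of_vc
    (Q := fun σ' => σ' = ((σ.setV .pos 3).setV .edge 0).setV .dart 0) (by simp [hC.zero])) ?_)
  rintro _ t₃ ⟨ht₃, rfl⟩
  let I : Cfg → ℕ → Prop := fun σ' φ => ∃ e, BuildInv N σ σ' e ∧ φ = 33 * (N.m - e)
  have h0 : BuildInv N σ (((σ.setV .pos 3).setV .edge 0).setV .dart 0) 0 := by
    refine ⟨by omega, ⟨by simp, by simp, ?_⟩, by simp, by simp, by simp, by simp, by simp, by simp,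
      by simp⟩
    intro x _
    simp [ha, Net.adjUpTo, Chain]
  have key := Cmd.wp_loop (C := C) (b := .lt Var.edge Con.edges) (p := buildStep) I ?_
    ⟨0, h0, rfl⟩
  · refine Cmd.wp_mono key ?_
    rintro σ' t₄ ⟨hb, φ, ⟨e, hinv, rfl⟩, ht₄⟩
    simp only [Cond.holds_lt, Opd.val_var, Opd.val_con, hinv.edge, hCe] at hb
    obtain rfl : e = N.m := le_antisymm hinv.le (not_lt.1 hb)
    refine ⟨⟨⟨hinv.built.dst, hinv.built.eid, hinv.built.adj⟩, ?_, ?_, ?_, ?_, ?_⟩, ?_⟩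
    · rw [hinv.arr .status (by simp) (by simp) (by simp) (by simp), ha _ (by simp)]
    · rw [hinv.arr .mark (by simp) (by simp) (by simp) (by simp), ha _ (by simp)]
    · rw [hinv.stamp, hv]
    · rw [hinv.popped, hv]
    · rw [hinv.pushed, hv]
    · change t₁ ≤ 1 at ht₁
      change t₂ ≤ 1 at ht₂
      change t₃ ≤ 1 at ht₃
      omega
  · rintro σ' φ ⟨e, hinv, rfl⟩ hb
    simp only [Cond.holds_lt, Opd.val_var, Opd.val_con, hinv.edge, hCe] at hb
    refine Cmd.wp_mono (Cmd.wp_of_vc (buildStep_vc hC hw hinv hb)) ?_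
    rintro σ'' t ⟨ht, h'⟩
    rw [buildStep_cost] at ht
    exact ⟨_, ⟨e + 1, h', rfl⟩, by omega⟩

/-! ### Computing the constants -/

open WordRAM

/-- Instructions that load the constants and the addresses of the arrays. The registers of
`Con.zero` and of the array `input`, which starts at the address `0`, contain `0` already. -/
def preludeInstrs : List Instr := [
  .const Con.one.reg 1, .const Con.two.reg 2,
  .load Con.verts.reg Con.zero.reg, .load Con.firstLen.reg Con.one.reg,
  .load Con.edges.reg Con.two.reg, .add Con.edges.reg Con.edges.reg Con.firstLen.reg,
  .add Con.nodes.reg Con.verts.reg Con.verts.reg,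
  .add Arr.dst.reg Con.nodes.reg Con.nodes.reg,
  .add Arr.eid.reg Arr.dst.reg Arr.dst.reg,
  .add Arr.next.reg Arr.eid.reg Arr.dst.reg,
  .add Arr.head.reg Arr.next.reg Arr.dst.reg,
  .add Arr.status.reg Arr.head.reg Arr.dst.reg,
  .add Arr.mark.reg Arr.status.reg Arr.dst.reg,
  .add Arr.queue.reg Arr.mark.reg Arr.dst.reg,
  .add Arr.del.reg Arr.queue.reg Arr.dst.reg]

/-- The program that executes a list of instructions. -/
def progOfInstrs : List Instr → Prog
  | [] => .skip
  | i :: l => .seq (.instr i) (progOfInstrs l)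

theorem exec_progOfInstrs (w : ℕ) (l : List Instr) (s : State) :
    Exec w (progOfInstrs l) s (l.foldl (fun s i => i.exec w s) s) (l.length + 1) := by
  induction l generalizing s with
  | nil => exact .skip s
  | cons i l ih =>
    have := Exec.seq (.instr (w := w) i s) (ih (i.exec w s))
    rwa [add_comm] at this

/-- The context for an input with `n` vertices, `m` edges, `firstLen` of them in the first
forest. -/
def mkCtx (n firstLen m w : ℕ) (h : 36 * n ≤ 2 ^ w) : Ctx where
  con
    | .zero => 0
    | .one => 1
    | .two => 2
    | .verts => n
    | .nodes => 2 * n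
    | .firstLen => firstLen
    | .edges => m
  len := 4 * n
  w := w
  fits := by omega

@[simp] theorem _root_.WordRAM.State.setReg_reg (s : State) (d k r : ℕ) :
    (s.setReg d k).reg r = if r = d then k else s.reg r := by
  simp [State.setReg, Function.update_apply]

@[simp] theorem Con.reg_inj {c c' : Con} : c.reg = c'.reg ↔ c = c' := by
  refine ⟨fun h => ?_, fun h => h ▸ rfl⟩
  have : c.ctorIdx = c'.ctorIdx := by unfold Con.reg at h; omega
  cases c <;> cases c' <;> first | rfl | (exact absurd this (by decide))

@[simp] theorem Arr.reg_inj {j j' : Arr} : j.reg = j'.reg ↔ j = j' := by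
  refine ⟨fun h => Arr.ctorIdx_injective ?_, fun h => h ▸ rfl⟩
  unfold Arr.reg at h; omega

@[simp] theorem Con.reg_ne_arr (c : Con) (j : Arr) : c.reg ≠ j.reg := by
  simp only [Con.reg, Arr.reg]; omega

@[simp] theorem Arr.reg_ne_con (c : Con) (j : Arr) : j.reg ≠ c.reg := (Con.reg_ne_arr c j).symm

@[simp] theorem Var.reg_ne_con (x : Var) (c : Con) : x.reg ≠ c.reg := by
  simp only [Con.reg, Var.reg]; omega

@[simp] theorem Var.reg_ne_arr (x : Var) (j : Arr) : x.reg ≠ j.reg := by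
  simp only [Arr.reg, Var.reg]; omega

section Steps

variable {C : Ctx} {σ : Cfg} {w : ℕ} {l : List Instr} {s : State} {d a b x y z : ℕ}

theorem Rep.step_const (hx : x < 2 ^ w)
    (h : Rep C (l.foldl (fun s i => i.exec w s) (s.setReg d x)) σ) :
    Rep C ((Instr.const d x :: l).foldl (fun s i => i.exec w s) s) σ := by
  rwa [List.foldl_cons, Instr.exec, Nat.mod_eq_of_lt hx]

theorem Rep.step_load (ha : s.mem (s.reg a) = x)
    (h : Rep C (l.foldl (fun s i => i.exec w s) (s.setReg d x)) σ) :
    Rep C ((Instr.load d a :: l).foldl (fun s i => i.exec w s) s) σ := by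
  rwa [List.foldl_cons, Instr.exec, ha]

theorem Rep.step_add (ha : s.reg a = x) (hb : s.reg b = y) (hz : x + y = z) (hlt : z < 2 ^ w)
    (h : Rep C (l.foldl (fun s i => i.exec w s) (s.setReg d z)) σ) :
    Rep C ((Instr.add d a b :: l).foldl (fun s i => i.exec w s) s) σ := by
  rwa [List.foldl_cons, Instr.exec, ha, hb, hz, Nat.mod_eq_of_lt hlt]

end Steps

/-- The input occupies the first of the nine arrays; it is shorter than `4 n`, and the rest of the
memory is `0`. -/
theorem prelude_exec {words : List ℕ} {n firstLen secondLen w : ℕ} (hn : 2 ≤ n)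
    (hlen : words.length < 4 * n) (h0 : words.getD 0 0 = n) (h1 : words.getD 1 0 = firstLen)
    (h2 : words.getD 2 0 = secondLen) (hm : firstLen + secondLen + 3 = 2 * n)
    (hw : 36 * n ≤ 2 ^ w) :
    ∃ s, Exec w (progOfInstrs preludeInstrs) (initial words) s 16 ∧
      Rep (mkCtx n firstLen (firstLen + secondLen) w hw) s
        { v := fun _ => 0, a := fun j i => if j = .input then words.getD i 0 else 0 } := by
  refine ⟨_, exec_progOfInstrs w _ _, ?_⟩
  -- Changes of registers do not affect the memory.
  have hmem : ∀ (d₁ k₁ d₂ k₂ d₃ k₃ d₄ k₄ i : ℕ),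
      ((initial words).setReg d₁ k₁ |>.setReg d₂ k₂).mem i = words.getD i 0 ∧
      ((initial words).setReg d₁ k₁ |>.setReg d₂ k₂ |>.setReg d₃ k₃).mem i = words.getD i 0 ∧
      ((initial words).setReg d₁ k₁ |>.setReg d₂ k₂ |>.setReg d₃ k₃ |>.setReg d₄ k₄).mem i =
        words.getD i 0 := fun _ _ _ _ _ _ _ _ _ => ⟨rfl, rfl, rfl⟩
  refine Rep.step_const (by omega) (Rep.step_const (by omega) ?_)
  refine Rep.step_load (x := n) (by rw [(hmem _ _ _ _ 0 0 0 0 _).1, ← h0]; simp [initial]) ?_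
  refine Rep.step_load (x := firstLen)
    (by rw [(hmem _ _ _ _ _ _ 0 0 _).2.1, ← h1]; simp [initial]) ?_
  refine Rep.step_load (x := secondLen)
    (by rw [(hmem _ _ _ _ _ _ _ _ _).2.2, ← h2]; simp [initial]) ?_
  refine Rep.step_add (x := secondLen) (y := firstLen) (z := firstLen + secondLen) (by simp)
    (by simp) (by omega) (by omega) ?_
  refine Rep.step_add (x := n) (y := n) (z := 2 * n) (by simp) (by simp) (by omega) (by omega) ?_
  refine Rep.step_add (x := 2 * n) (y := 2 * n) (z := 1 * (4 * n)) (by simp) (by simp)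
    (by omega) (by omega) ?_
  refine Rep.step_add (x := 4 * n) (y := 4 * n) (z := 2 * (4 * n)) (by simp) (by simp)
    (by omega) (by omega) ?_
  refine Rep.step_add (x := 2 * (4 * n)) (y := 4 * n) (z := 3 * (4 * n)) (by simp) (by simp)
    (by omega) (by omega) ?_
  refine Rep.step_add (x := 3 * (4 * n)) (y := 4 * n) (z := 4 * (4 * n)) (by simp) (by simp)
    (by omega) (by omega) ?_
  refine Rep.step_add (x := 4 * (4 * n)) (y := 4 * n) (z := 5 * (4 * n)) (by simp) (by simp)
    (by omega) (by omega) ?_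
  refine Rep.step_add (x := 5 * (4 * n)) (y := 4 * n) (z := 6 * (4 * n)) (by simp) (by simp)
    (by omega) (by omega) ?_
  refine Rep.step_add (x := 6 * (4 * n)) (y := 4 * n) (z := 7 * (4 * n)) (by simp) (by simp)
    (by omega) (by omega) ?_
  refine Rep.step_add (x := 7 * (4 * n)) (y := 4 * n) (z := 8 * (4 * n)) (by simp) (by simp)
    (by omega) (by omega) ?_
  refine ⟨?_, ?_, ?_, ?_⟩
  · intro x; simp [initial]
  · intro c; cases c <;> simp [mkCtx, initial]
  · intro j; cases j <;> simp [mkCtx, initial, Arr.ctorIdx]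
  · intro j i hi
    change words.getD _ 0 = _
    cases j with
    | input => simp [Arr.ctorIdx]
    | _ =>
      simp only [reduceCtorEq, if_false]
      refine List.getD_eq_default _ _ ?_
      simp [mkCtx, Arr.ctorIdx]
      omega

end LamanRAM

/-! ### Forests and connected subgraphs -/
namespace LamanRAM
open SimpleGraph

variable {V : Type*}

/-- A forest with at least one vertex is contained in a spanning tree. -/
theorem exists_isTree_ge [Nonempty V] {F : SimpleGraph V} (hF : F.IsAcyclic) :
    ∃ T, F ≤ T ∧ T.IsTree := by
  obtain ⟨T, hFT, hT⟩ := exists_maximal_isAcyclic_of_le_isAcyclic (le_top : F ≤ ⊤) hF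
  refine ⟨T, hFT, maximal_isAcyclic_iff_isTree.1 ⟨hT.prop.2, fun H hH hTH => ?_⟩⟩
  exact hT.2 ⟨le_top, hH⟩ hTH

theorem isTree_ncard [Finite V] {T : SimpleGraph V} (hT : T.IsTree) :
    T.edgeSet.ncard + 1 = Nat.card V :=
  (isTree_iff_connected_and_card.1 hT).2

theorem acyclic_ncard_le [Finite V] [Nonempty V] {F : SimpleGraph V} (hF : F.IsAcyclic) :
    F.edgeSet.ncard + 1 ≤ Nat.card V := by
  obtain ⟨T, hFT, hT⟩ := exists_isTree_ge hF
  rw [← isTree_ncard hT]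
  exact Nat.succ_le_succ (Set.ncard_le_ncard (edgeSet_mono hFT) (Set.toFinite _))

theorem acyclic_connected [Finite V] [Nonempty V] {F : SimpleGraph V} (hF : F.IsAcyclic)
    (h : Nat.card V ≤ F.edgeSet.ncard + 1) : F.Connected := by
  obtain ⟨T, hFT, hT⟩ := exists_isTree_ge hF
  rw [← isTree_ncard hT] at h
  have := Set.eq_of_subset_of_ncard_le (edgeSet_mono hFT) (by omega) (Set.toFinite _)
  rw [edgeSet_inj.1 this]
  exact hT.connected

/-- A forest on `k` vertices with `k - 2` edges has only two components. -/
theorem acyclic_two_components [Finite V] {F : SimpleGraph V} (hF : F.IsAcyclic)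
    (h : F.edgeSet.ncard + 2 = Nat.card V) {r a b : V} (ha : ¬ F.Reachable r a)
    (hb : ¬ F.Reachable r b) : F.Reachable a b := by
  have : Nonempty V := ⟨r⟩
  have hra : r ≠ a := fun hh => ha (hh ▸ .refl _)
  have hadj : ¬ F.Adj r a := fun hh => ha hh.reachable
  have hF' : (F ⊔ edge r a).IsAcyclic := hF.sup_edge_of_not_reachable ha
  have hcard : (F ⊔ edge r a).edgeSet.ncard = F.edgeSet.ncard + 1 := by
    rw [edgeSet_sup, edgeSet_edge_of_ne hra, Set.union_singleton,
      Set.ncard_insert_of_notMem (by simpa using hadj) (Set.toFinite _)]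
  have hconn := acyclic_connected hF' (by omega)
  by_contra hab
  -- The vertices in neither of the components of `r` and `a` cannot be left along an edge.
  have key : ∀ x, (F ⊔ edge r a).Reachable b x → ¬ F.Reachable r x ∧ ¬ F.Reachable a x := by
    intro x hx
    rw [reachable_iff_reflTransGen] at hx
    induction hx with
    | refl => exact ⟨hb, hab⟩
    | @tail y z _ hyz ih =>
      rw [sup_adj] at hyz
      rcases hyz with hyz | hyz
      · exact ⟨fun h => ih.1 (h.trans hyz.symm.reachable),
          fun h => ih.2 (h.trans hyz.symm.reachable)⟩
      · rw [edge_adj] at hyz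
        rcases hyz.1 with ⟨rfl, rfl⟩ | ⟨rfl, rfl⟩
        · exact absurd (.refl _) ih.1
        · exact absurd (.refl _) ih.2
  exact (key r (hconn.preconnected b r)).1 (.refl _)

/-- The edges of `G` that are spanned by the vertex set `S`. -/
def spanned (G : SimpleGraph V) (S : Finset V) : Set (Sym2 V) :=
  {e | e ∈ G.edgeSet ∧ ∀ v ∈ e, v ∈ S}

theorem ncard_spanned (G : SimpleGraph V) (S : Finset V) :
    (spanned G S).ncard = (G.induce (S : Set V)).edgeSet.ncard := by
  have : spanned G S = Sym2.map Subtype.val '' (G.induce (S : Set V)).edgeSet := by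
    ext e
    induction e with
    | _ a b =>
      simp only [spanned, Set.mem_ofPred_eq, mem_edgeSet, Sym2.mem_iff, Set.mem_image]
      constructor
      · rintro ⟨h, hS⟩
        exact ⟨s(⟨a, hS a (.inl rfl)⟩, ⟨b, hS b (.inr rfl)⟩), h, rfl⟩
      · rintro ⟨e', he', h⟩
        induction e' with
        | _ a' b' =>
          rw [mem_edgeSet, induce_adj] at he'
          rw [Sym2.map_mk, Sym2.eq_iff] at h
          rcases h with ⟨rfl, rfl⟩ | ⟨rfl, rfl⟩
          · exact ⟨he', by rintro v (rfl | rfl); exacts [a'.2, b'.2]⟩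
          · exact ⟨he'.symm, by rintro v (rfl | rfl); exacts [b'.2, a'.2]⟩
  rw [this, Set.ncard_image_of_injective _ (Sym2.map.injective Subtype.val_injective)]

theorem ncard_spanned_sup [Finite V] {F₁ F₂ : SimpleGraph V} (h : Disjoint F₁ F₂)
    (S : Finset V) :
    (spanned (F₁ ⊔ F₂) S).ncard = (spanned F₁ S).ncard + (spanned F₂ S).ncard := by
  rw [← Set.ncard_union_eq _ (Set.toFinite _) (Set.toFinite _)]
  · congr 1
    ext e
    simp only [spanned, edgeSet_sup, Set.mem_union, Set.mem_ofPred_eq]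
    tauto
  · rw [Set.disjoint_left]
    rintro e he he'
    exact Set.disjoint_left.1 (disjoint_edgeSet.2 h) he.1 he'.1

/-- The graph is the union of two disjoint forests with `2 n - 3` edges. It is not a Laman graph if
and only if both forests are connected on a common set of at least two vertices. -/
theorem isLaman_iff [Fintype V] {G F₁ F₂ : SimpleGraph V} (hF : IsForestPartition G F₁ F₂)
    (hcard : G.edgeSet.ncard + 3 = 2 * Fintype.card V) :
    IsLaman G ↔ ∀ S : Finset V, 2 ≤ S.card →
      ¬ ((F₁.induce (S : Set V)).Connected ∧ (F₂.induce (S : Set V)).Connected) := by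
  have hncard : ∀ S : Finset V, {e : Sym2 V | e ∈ G.edgeSet ∧ ∀ v ∈ e, v ∈ S}.ncard =
      (F₁.induce (S : Set V)).edgeSet.ncard + (F₂.induce (S : Set V)).edgeSet.ncard := by
    intro S
    have h := ncard_spanned_sup hF.disjoint S
    rw [hF.union, ncard_spanned F₁, ncard_spanned F₂] at h
    exact h
  rw [IsLaman, and_iff_right hcard]
  refine forall_congr' fun S => imp_congr_right fun hS => ?_
  have hne : Nonempty (S : Set V) := by
    obtain ⟨v, hv⟩ := Finset.card_pos.1 (by omega : 0 < S.card)
    exact ⟨⟨v, hv⟩⟩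
  have hcS : Nat.card (S : Set V) = S.card := by simp
  have h1 := acyclic_ncard_le (hF.left_acyclic.induce (S : Set V))
  have h2 := acyclic_ncard_le (hF.right_acyclic.induce (S : Set V))
  rw [hncard]
  constructor
  · rintro h ⟨hc1, hc2⟩
    have h3 := hc1.card_vert_le_card_edgeSet_add_one
    have h4 := hc2.card_vert_le_card_edgeSet_add_one
    rw [hcS] at h1 h2
    rw [hcS, Nat.card_coe_set_eq] at h3 h4
    omega
  · intro h
    by_contra hlt
    refine h ⟨acyclic_connected (hF.left_acyclic.induce _) ?_,
      acyclic_connected (hF.right_acyclic.induce _) ?_⟩ <;> omega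

end LamanRAM

/-! ### The forest on two copies of the vertex set -/
namespace LamanRAM
open SimpleGraph

/-- The copy of the vertex `v` that belongs to the first (`c = false`) or to the second forest. -/
def copy (n : ℕ) (c : Bool) (v : Fin n) : ℕ := v + if c then n else 0

theorem copy_inj {n : ℕ} {c c' : Bool} {v v' : Fin n} (h : copy n c v = copy n c' v') :
    c = c' ∧ v = v' := by
  have h1 := v.2
  have h2 := v'.2
  unfold copy at h
  cases c <;> cases c' <;> simp at h ⊢ <;> first | (exact Fin.ext h) | omega

theorem copy_lt {n : ℕ} (c : Bool) (v : Fin n) : copy n c v < 2 * n := by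
  have := v.2
  unfold copy
  split <;> omega

/-- The forests `F false` and `F true` are given by the lists of their edges: the edges with numbers
below `k` belong to `F false`, those from `k` to `m - 1` to `F true`, and the edge `e` joins `A e`
and `B e`. -/
structure Code (n m k : ℕ) (F : Bool → SimpleGraph (Fin n)) (A B : ℕ → Fin n) : Prop where
  two_le : 2 ≤ n
  card : m + 3 = 2 * n
  acyclic : ∀ c, (F c).IsAcyclic
  card_false : (F false).edgeSet.ncard = k
  card_true : (F true).edgeSet.ncard + k = m
  adj : ∀ e < m, (F (decide (k ≤ e))).Adj (A e) (B e)
  surj : ∀ c a b, (F c).Adj a b → ∃ e < m, decide (k ≤ e) = c ∧ s(A e, B e) = s(a, b)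
  inj : ∀ e < m, ∀ f < m, decide (k ≤ e) = decide (k ≤ f) → s(A e, B e) = s(A f, B f) → e = f

section Graph

variable {n m k : ℕ} {F : Bool → SimpleGraph (Fin n)} {A B : ℕ → Fin n}

/-- The graph of the edges with the property `P` on the two copies of the vertex set. -/
def copyGraph (m k : ℕ) (A B : ℕ → Fin n) (P : ℕ → Prop) : SimpleGraph ℕ :=
  edgeGraph m (fun e => copy n (decide (k ≤ e)) (A e)) (fun e => copy n (decide (k ≤ e)) (B e)) P

/-- The graph of the edges of one of the forests with the property `P`. -/
def part (m k : ℕ) (A B : ℕ → Fin n) (P : ℕ → Prop) (c : Bool) : SimpleGraph (Fin n) :=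
  (copyGraph m k A B P).comap (copy n c)

theorem part_adj {P : ℕ → Prop} {c : Bool} {a b : Fin n} : (part m k A B P c).Adj a b ↔
    a ≠ b ∧ ∃ e < m, P e ∧ decide (k ≤ e) = c ∧ s(A e, B e) = s(a, b) := by
  simp only [part, copyGraph, comap_adj, edgeGraph, Sym2.eq_iff]
  refine and_congr ⟨fun h hab => h (hab ▸ rfl), fun h hab => h (copy_inj hab).2⟩ ?_
  refine exists_congr fun e => and_congr_right fun _ => and_congr_right fun _ => ?_
  constructor
  · rintro (⟨h1, h2⟩ | ⟨h1, h2⟩)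
    · exact ⟨(copy_inj h1).1, .inl ⟨(copy_inj h1).2, (copy_inj h2).2⟩⟩
    · exact ⟨(copy_inj h1).1, .inr ⟨(copy_inj h1).2, (copy_inj h2).2⟩⟩
  · rintro ⟨rfl, ⟨rfl, rfl⟩ | ⟨rfl, rfl⟩⟩
    · exact .inl ⟨rfl, rfl⟩
    · exact .inr ⟨rfl, rfl⟩

/-- A component of the graph on the two copies lies in one copy. -/
theorem exists_copy_of_reachable {P : ℕ → Prop} {c : Bool} {a : Fin n} {z : ℕ}
    (h : (copyGraph m k A B P).Reachable (copy n c a) z) :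
    ∃ v, z = copy n c v ∧ (part m k A B P c).Reachable a v := by
  rw [reachable_iff_reflTransGen] at h
  induction h with
  | refl => exact ⟨a, rfl, .refl _⟩
  | @tail y z _ hyz ih =>
    obtain ⟨v, rfl, hv⟩ := ih
    obtain ⟨e, he, hP, h⟩ := hyz.2
    have hz : ∃ v', z = copy n c v' := by
      dsimp only at h
      rcases h with ⟨h1, h2⟩ | ⟨h1, h2⟩
      · rw [(copy_inj h1).1] at h2; exact ⟨_, h2.symm⟩
      · rw [(copy_inj h2).1] at h1; exact ⟨_, h1.symm⟩
    obtain ⟨v', rfl⟩ := hz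
    exact ⟨v', rfl, hv.trans (Adj.reachable (by exact hyz))⟩

theorem reachable_copy_iff {P : ℕ → Prop} {c : Bool} {a b : Fin n} :
    (copyGraph m k A B P).Reachable (copy n c a) (copy n c b) ↔
      (part m k A B P c).Reachable a b := by
  constructor
  · intro h
    obtain ⟨v, hv, h'⟩ := exists_copy_of_reachable h
    rwa [(copy_inj hv).2]
  · exact fun h => h.map (Hom.comap (copy n c) _)

theorem Code.part_le (h : Code n m k F A B) (P : ℕ → Prop) (c : Bool) :
    part m k A B P c ≤ F c := by
  intro a b hab
  obtain ⟨_, e, he, _, rfl, hs⟩ := part_adj.1 hab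
  have := h.adj e he
  rwa [← mem_edgeSet, hs, mem_edgeSet] at this

theorem Code.part_true (h : Code n m k F A B) (c : Bool) :
    part m k A B (fun _ => True) c = F c := by
  refine le_antisymm (h.part_le _ c) fun a b hab => ?_
  obtain ⟨e, he, hc, hs⟩ := h.surj c a b hab
  exact part_adj.2 ⟨hab.ne, e, he, trivial, hc, hs⟩

theorem Code.bridge (h : Code n m k F A B) {e : ℕ} (he : e < m) :
    ¬ (copyGraph m k A B (· ≠ e)).Reachable (copy n (decide (k ≤ e)) (A e))
      (copy n (decide (k ≤ e)) (B e)) := by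
  rw [reachable_copy_iff]
  intro hr
  refine isAcyclic_iff_forall_adj_isBridge.1 (h.acyclic _) (h.adj e he) (hr.mono ?_)
  intro a b hab
  rw [deleteEdges_adj]
  refine ⟨h.part_le _ _ hab, fun hs => ?_⟩
  obtain ⟨_, f, hf, hfe, hc, hs'⟩ := part_adj.1 hab
  exact hfe (h.inj f hf e he hc (hs'.trans hs))

/-- The forest on the two copies of the vertex set. -/
def Code.net (h : Code n m k F A B) : Net where
  n := n
  m := m
  X e := copy n (decide (k ≤ e)) (A e)
  Y e := copy n (decide (k ≤ e)) (B e)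
  two_le := h.two_le
  card := h.card
  X_lt _ _ := copy_lt _ _
  Y_lt _ _ := copy_lt _ _
  bridge _ he := h.bridge he

theorem Code.tw_copy (h : Code n m k F A B) (c : Bool) (v : Fin n) :
    h.net.tw (copy n c v) = copy n (!c) v := by
  have := v.2
  unfold Net.tw copy
  change (if _ < n then _ + n else _ - n) = _
  cases c <;> simp

theorem Code.gr_net (h : Code n m k F A B) (P : ℕ → Prop) :
    h.net.gr P = copyGraph m k A B P := rfl

/-! ### Supported sets and Laman graphs -/

/-- A set of vertices on which both forests are connected spans a supported set of edges, and
the vertices of a component of a nonempty supported set form such a set of vertices. -/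
theorem Code.supported_iff (h : Code n m k F A B) :
    (∀ Z, h.net.Supported Z → Z = ∅) ↔ ∀ S : Finset (Fin n), 2 ≤ S.card →
      ¬ (((F false).induce (S : Set (Fin n))).Connected ∧
        ((F true).induce (S : Set (Fin n))).Connected) := by
  constructor
  · rintro hZ S hS ⟨hc1, hc2⟩
    have hconn : ∀ c, ((F c).induce (S : Set (Fin n))).Connected := by
      rintro (_ | _) <;> assumption
    set Z : Set ℕ := {e | e < m ∧ A e ∈ S ∧ B e ∈ S} with hZ_def
    have hsub : ∀ c a b, a ∈ S → b ∈ S → (part m k A B (· ∈ Z) c).Reachable a b := by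
      intro c a b ha hb
      have hr := (hconn c).preconnected ⟨a, ha⟩ ⟨b, hb⟩
      refine hr.map (G' := part m k A B (· ∈ Z) c) ⟨Subtype.val, ?_⟩
      rintro ⟨x, hx⟩ ⟨y, hy⟩ hxy
      rw [induce_adj] at hxy
      obtain ⟨e, he, hce, hs⟩ := h.surj c x y hxy
      refine part_adj.2 ⟨hxy.ne, e, he, ⟨he, ?_⟩, hce, hs⟩
      rw [Sym2.eq_iff] at hs
      rcases hs with ⟨h1, h2⟩ | ⟨h1, h2⟩
      · rw [h1, h2]; exact ⟨hx, hy⟩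
      · rw [h1, h2]; exact ⟨hy, hx⟩
    have hsupp : h.net.Supported Z := by
      rintro e ⟨he, ha, hb⟩
      refine ⟨he, ?_⟩
      change (h.net.gr _).Reachable (h.net.tw (copy n _ _)) (h.net.tw (copy n _ _))
      rw [h.tw_copy, h.tw_copy, h.gr_net, reachable_copy_iff]
      exact hsub _ _ _ ha hb
    obtain ⟨a, ha, b, hb, hab⟩ := Finset.one_lt_card.1 hS
    have hr := hsub false a b ha hb
    rw [reachable_iff_reflTransGen] at hr
    rcases Relation.ReflTransGen.cases_head hr with hr | ⟨x, hx, _⟩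
    · exact hab hr
    · obtain ⟨_, e, _, he, _⟩ := part_adj.1 hx
      rw [hZ Z hsupp] at he
      exact he
  · intro hS Z hZ
    by_contra hne
    obtain ⟨e, he⟩ := Set.nonempty_iff_ne_empty.2 hne
    -- An edge of `Z` in one copy is replaced by a path in the other copy.
    have hstep : ∀ c a b, (part m k A B (· ∈ Z) c).Reachable a b →
        (part m k A B (· ∈ Z) (!c)).Reachable a b := by
      intro c a b hab
      rw [reachable_iff_reflTransGen] at hab
      induction hab with
      | refl => exact .refl _
      | tail _ hyz ih =>
        obtain ⟨_, f, _, hf, rfl, hs⟩ := part_adj.1 hyz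
        have := (hZ f hf).2
        change (h.net.gr _).Reachable (h.net.tw (copy n _ _)) (h.net.tw (copy n _ _)) at this
        rw [h.tw_copy, h.tw_copy, h.gr_net, reachable_copy_iff] at this
        refine ih.trans ?_
        rw [Sym2.eq_iff] at hs
        rcases hs with ⟨h1, h2⟩ | ⟨h1, h2⟩
        · rwa [h1, h2] at this
        · rw [h1, h2] at this; exact this.symm
    have hall : ∀ c c' a b, (part m k A B (· ∈ Z) c).Reachable a b →
        (part m k A B (· ∈ Z) c').Reachable a b := by
      intro c c' a b hab
      by_cases hcc : c' = c
      · rwa [hcc]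
      · rw [Bool.eq_not.2 hcc]; exact hstep c a b hab
    classical
    set S : Finset (Fin n) :=
      Finset.univ.filter fun v => (part m k A B (· ∈ Z) false).Reachable (A e) v with hS_def
    have hconn : ∀ c, ((F c).induce (S : Set (Fin n))).Connected := by
      intro c
      have hset : (S : Set (Fin n)) =
          ((part m k A B (· ∈ Z) c).connectedComponentMk (A e)).supp := by
        ext v
        rw [ConnectedComponent.mem_supp_iff, ConnectedComponent.eq]
        simp only [hS_def, Finset.coe_filter, Finset.mem_univ, true_and, Set.mem_ofPred_eq]
        exact ⟨fun hv => (hall _ _ _ _ hv).symm, fun hv => (hall _ _ _ _ hv).symm⟩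
      rw [hset]
      refine Connected.mono ?_ (ConnectedComponent.connected_toSimpleGraph _)
      intro x y hxy
      exact h.part_le _ _ hxy
    refine hS S (Finset.one_lt_card.2 ⟨A e, by simp [hS_def], B e, ?_, ?_⟩)
      ⟨hconn false, hconn true⟩
    · have hadj : (part m k A B (· ∈ Z) (decide (k ≤ e))).Adj (A e) (B e) :=
        part_adj.2 ⟨(h.adj e (hZ e he).1).ne, e, (hZ e he).1, he, rfl, rfl⟩
      simpa [hS_def] using hall _ false _ _ hadj.reachable
    · exact (h.adj e (hZ e he).1).ne

/-! ### The two trees that contain the copies of the vertex `0` -/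

/-- The nodes of one copy. -/
def copyNodes (n : ℕ) (c : Bool) : Finset ℕ := if c then Finset.Ico n (2 * n) else Finset.range n

theorem mem_copyNodes {c : Bool} {x : ℕ} : x ∈ copyNodes n c ↔ ∃ v, x = copy n c v := by
  unfold copyNodes copy
  cases c
  · simp only [Bool.false_eq_true, if_false, Finset.mem_range, add_zero]
    exact ⟨fun h => ⟨⟨x, h⟩, rfl⟩, fun ⟨v, hv⟩ => hv ▸ v.2⟩
  · simp only [if_true, Finset.mem_Ico]
    refine ⟨fun h => ⟨⟨x - n, by omega⟩, by simp; omega⟩, ?_⟩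
    rintro ⟨v, rfl⟩
    have := v.2
    omega

/-- Since the edges of the first forest come first, the first `2 k` darts are those with a tail in
the first copy. -/
theorem Code.sum_adjUpTo (h : Code n m k F A B) {j : ℕ} (hj : j ≤ 2 * m) :
    ∑ x ∈ Finset.range n, (h.net.adjUpTo j x).length = min j (2 * k) := by
  induction j with
  | zero => simp [Net.adjUpTo]
  | succ j ih =>
    have hstep : ∀ x, (h.net.adjUpTo (j + 1) x).length =
        (h.net.adjUpTo j x).length + if h.net.src j = x then 1 else 0 := by
      intro x; rw [Net.adjUpTo]; split <;> simp
    have hsrc : h.net.src j < n ↔ j < 2 * k := by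
      have h1 := (A (j / 2)).2
      have h2 := (B (j / 2)).2
      have : h.net.src j = if j % 2 = 0 then copy n (decide (k ≤ j / 2)) (A (j / 2))
        else copy n (decide (k ≤ j / 2)) (B (j / 2)) := rfl
      rw [this]
      unfold copy
      by_cases hk : k ≤ j / 2
      · simp only [hk, decide_true, if_true]
        split <;> omega
      · simp only [hk, decide_false, Bool.false_eq_true, if_false]
        split <;> omega
    simp only [hstep, Finset.sum_add_distrib, ih (by omega), Finset.sum_ite_eq,
      Finset.mem_range, hsrc]
    split <;> omega

/-- The weight of a copy is determined by the number of edges of the forest. -/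
theorem Code.sum_wt_copyNodes (h : Code n m k F A B) (c : Bool) :
    ∑ x ∈ copyNodes n c, h.net.wt x = n + 2 * (F c).edgeSet.ncard := by
  have hc1 := h.card_false
  have hc2 := h.card_true
  have hfalse : ∑ x ∈ Finset.range n, h.net.wt x = n + 2 * k := by
    have : ∑ x ∈ Finset.range n, (h.net.adj x).length = 2 * k := by
      have := h.sum_adjUpTo le_rfl
      rw [Nat.min_eq_right (by omega)] at this
      exact this
    simp only [Net.wt, Finset.sum_add_distrib, this]
    simp
  cases c
  · rw [hc1]; simpa [copyNodes] using hfalse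
  · have htot : ∑ x ∈ Finset.range (2 * n), h.net.wt x = 2 * n + 2 * m := Net.sum_wt
    have hsplit := Finset.sum_range_add_sum_Ico (fun x => h.net.wt x) (show n ≤ 2 * n by omega)
    simp only [copyNodes, if_true]
    omega

open Classical in
/-- The component of the copy of `0` in the forest with two trees is lighter than the other forest,
which is a single tree. Two nodes of the first forest which are on the same side of it are
connected, because there are only two trees. -/
theorem Code.start (h : Code n m k F A B) : h.net.Start := by
  have hn := h.two_le
  have hcard := h.card
  have hc1 := h.card_false
  have hc2 := h.card_true
  have : Nonempty (Fin n) := ⟨⟨0, by omega⟩⟩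
  set o : Fin n := ⟨0, by omega⟩ with ho
  have ho1 : (0 : ℕ) = copy n false o := by simp [copy, ho]
  have ho2 : n = copy n true o := by simp [copy, ho]
  have hle : ∀ c, (F c).edgeSet.ncard + 1 ≤ n := fun c => by
    simpa using acyclic_ncard_le (h.acyclic c)
  have hdiff : ∀ c v v', ¬ (copyGraph m k A B fun _ => True).Reachable (copy n c v)
      (copy n (!c) v') := by
    intro c v v' hr
    obtain ⟨u, hu, _⟩ := exists_copy_of_reachable hr
    simpa using (copy_inj hu).1
  have hcomp : ∀ c v, h.net.comp (fun _ => True) (copy n c v) ⊆ copyNodes n c := by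
    intro c v x hx
    rw [Net.comp, Finset.mem_filter] at hx
    obtain ⟨u, hu, _⟩ := exists_copy_of_reachable hx.2
    exact mem_copyNodes.2 ⟨u, hu⟩
  -- One of the forests is a spanning tree, and the other one has two components.
  obtain ⟨t, ht, hs⟩ : ∃ t, (F t).edgeSet.ncard + 1 = n ∧ (F (!t)).edgeSet.ncard + 2 = n := by
    have h1 := hle false
    have h2 := hle true
    by_cases hk : k + 1 = n
    · exact ⟨false, by omega, by simp only [Bool.not_false]; omega⟩
    · exact ⟨true, by omega, by simp only [Bool.not_true]; omega⟩
  have hconn : (F t).Connected := acyclic_connected (h.acyclic t) (by simp; omega)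
  have htree : ∀ v v', (copyGraph m k A B fun _ => True).Reachable (copy n t v) (copy n t v') := by
    intro v v'
    rw [reachable_copy_iff, h.part_true]
    exact hconn.preconnected v v'
  have hlight : h.net.compWt (fun _ => True) (copy n (!t) o) <
      h.net.compWt (fun _ => True) (copy n t o) := by
    have heq : h.net.comp (fun _ => True) (copy n t o) = copyNodes n t := by
      refine (hcomp t o).antisymm fun x hx => ?_
      obtain ⟨v, rfl⟩ := mem_copyNodes.1 hx
      rw [Net.comp, Finset.mem_filter]
      exact ⟨Finset.mem_range.2 (copy_lt _ _), htree o v⟩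
    have h1 := Finset.sum_le_sum_of_subset (f := h.net.wt) (hcomp (!t) o)
    have h2 := h.sum_wt_copyNodes t
    have h3 := h.sum_wt_copyNodes (!t)
    rw [Net.compWt, Net.compWt, heq]
    omega
  constructor
  · intro hr
    refine hdiff false o o ?_
    rw [← ho1]
    change (copyGraph m k A B _).Reachable 0 n at hr
    convert hr using 1
    exact ho2.symm
  · intro r r' hrr hwt e he hiff
    obtain ⟨c, rfl, rfl⟩ : ∃ c, r = copy n c o ∧ r' = copy n (!c) o := by
      rcases hrr with ⟨h1, h2⟩ | ⟨h1, h2⟩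
      · exact ⟨false, h1.trans ho1, h2.trans ho2⟩
      · exact ⟨true, h1.trans ho2, h2.trans ho1⟩
    have hc : c = !t := by
      by_contra hne
      obtain rfl : c = t := by simpa using hne
      omega
    subst hc
    change ((h.net.gr _).Reachable _ (h.net.tw (copy n _ _)) ↔
      (h.net.gr _).Reachable _ (h.net.tw (copy n _ _))) at hiff
    change (h.net.gr _).Reachable (h.net.tw (copy n _ _)) (h.net.tw (copy n _ _))
    rw [h.tw_copy, h.tw_copy, h.gr_net] at hiff ⊢
    generalize (!decide (k ≤ e)) = d at hiff ⊢
    by_cases hd : d = t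
    · subst hd; exact htree _ _
    · obtain rfl : d = !t := Bool.eq_not.2 hd
      simp only [reachable_copy_iff, h.part_true] at hiff ⊢
      by_cases ha : (F (!t)).Reachable o (A e)
      · exact ha.symm.trans (hiff.1 ha)
      · exact acyclic_two_components (h.acyclic _) (by simpa using hs) ha fun hb => ha (hiff.2 hb)

end Graph
end LamanRAM

/-! ### Edge lists as input -/
namespace LamanRAM
open SimpleGraph WordRAM

section EdgeList

variable {n : ℕ} {F : SimpleGraph (Fin n)} {L : List (Fin n × Fin n)}

theorem ncard_edgeSet_of_isEdgeList (h : IsEdgeList F L) : F.edgeSet.ncard = L.length := by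
  classical
  have : F.edgeSet = ((L.map fun p => s(p.1, p.2)).toFinset : Set (Sym2 (Fin n))) := by
    ext e
    rw [← h.2 e]
    simp
  rw [this, Set.ncard_coe_finset, List.toFinset_card_of_nodup h.1, List.length_map]

theorem adj_of_isEdgeList (h : IsEdgeList F L) (i : ℕ) (hi : i < L.length) :
    F.Adj L[i].1 L[i].2 := by
  rw [← mem_edgeSet, ← h.2, List.mem_map]
  exact ⟨L[i], List.getElem_mem hi, rfl⟩

theorem exists_getElem_of_isEdgeList (h : IsEdgeList F L) {a b : Fin n} (hab : F.Adj a b) :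
    ∃ (i : ℕ) (hi : i < L.length), s(L[i].1, L[i].2) = s(a, b) := by
  rw [← mem_edgeSet, ← h.2, List.mem_map] at hab
  obtain ⟨p, hp, hs⟩ := hab
  obtain ⟨i, hi, rfl⟩ := List.getElem_of_mem hp
  exact ⟨i, hi, hs⟩

theorem getElem_inj_of_isEdgeList (h : IsEdgeList F L) {i j : ℕ} (hi : i < L.length)
    (hj : j < L.length) (hs : s(L[i].1, L[i].2) = s(L[j].1, L[j].2)) : i = j :=
  (h.1.getElem_inj_iff (hi := by simpa using hi) (hj := by simpa using hj)).1 (by simpa using hs)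

theorem length_endpoints (L : List (Fin n × Fin n)) : (endpoints L).length = 2 * L.length := by
  induction L with
  | nil => rfl
  | cons p L ih =>
    simp only [endpoints, List.flatMap_cons, List.length_append, List.length_cons] at ih ⊢
    rw [ih]
    simp
    ring

theorem getD_endpoints (L : List (Fin n × Fin n)) (o : Fin n × Fin n) {e : ℕ}
    (he : e < L.length) : (endpoints L).getD (2 * e) 0 = (L.getD e o).1 ∧
      (endpoints L).getD (2 * e + 1) 0 = (L.getD e o).2 := by
  induction L generalizing e with
  | nil => simp at he
  | cons p L ih =>
    have hcons : endpoints (p :: L) = (p.1 : ℕ) :: (p.2 : ℕ) :: endpoints L := rfl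
    rw [hcons]
    cases e with
    | zero => exact ⟨rfl, rfl⟩
    | succ e =>
      have := ih (by simpa using he)
      simpa [Nat.mul_succ] using this

theorem inputWords_eq (L₁ L₂ : List (Fin n × Fin n)) :
    inputWords L₁ L₂ = n :: L₁.length :: L₂.length :: endpoints (L₁ ++ L₂) := by
  simp [inputWords, endpoints]

end EdgeList

section Input

variable {n : ℕ} {G F₁ F₂ : SimpleGraph (Fin n)} {L₁ L₂ : List (Fin n × Fin n)}

theorem ncard_edgeSet_of_isForestPartition (h : IsForestPartition G F₁ F₂) :
    G.edgeSet.ncard = F₁.edgeSet.ncard + F₂.edgeSet.ncard := by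
  rw [← h.union, edgeSet_sup,
    Set.ncard_union_eq (disjoint_edgeSet.2 h.disjoint) (Set.toFinite _) (Set.toFinite _)]

theorem code_of_isEdgeList (o : Fin n × Fin n) (hcard : G.edgeSet.ncard + 3 = 2 * n)
    (hF : IsForestPartition G F₁ F₂) (h₁ : IsEdgeList F₁ L₁) (h₂ : IsEdgeList F₂ L₂) :
    Code n (L₁.length + L₂.length) L₁.length (fun c => if c then F₂ else F₁)
      (fun e => ((L₁ ++ L₂).getD e o).1) (fun e => ((L₁ ++ L₂).getD e o).2) := by
  have hc₁ := ncard_edgeSet_of_isEdgeList h₁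
  have hc₂ := ncard_edgeSet_of_isEdgeList h₂
  have hc := ncard_edgeSet_of_isForestPartition hF
  have hleft : ∀ e (he : e < L₁.length), (L₁ ++ L₂).getD e o = L₁[e] := fun e he => by
    rw [List.getD_append _ _ _ _ he, List.getD_eq_getElem _ _ he]
  have hright : ∀ e (he : e - L₁.length < L₂.length), L₁.length ≤ e →
      (L₁ ++ L₂).getD e o = L₂[e - L₁.length] := fun e he hle => by
    rw [List.getD_append_right _ _ _ _ hle, List.getD_eq_getElem _ _ he]
  refine ⟨by omega, by omega, ?_, by simpa using hc₁, by simp; omega, ?_, ?_, ?_⟩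
  · rintro (_ | _)
    exacts [hF.left_acyclic, hF.right_acyclic]
  · intro e he
    by_cases hk : L₁.length ≤ e
    · simp only [hk, decide_true, if_true, hright e (by omega) hk]
      exact adj_of_isEdgeList h₂ _ _
    · simp only [hk, decide_false, Bool.false_eq_true, if_false, hleft e (by omega)]
      exact adj_of_isEdgeList h₁ _ _
  · rintro (_ | _) a b hab
    · obtain ⟨i, hi, hs⟩ := exists_getElem_of_isEdgeList h₁ hab
      exact ⟨i, by omega, by simpa using hi, by rw [hleft i hi, hs]⟩
    · obtain ⟨i, hi, hs⟩ := exists_getElem_of_isEdgeList h₂ hab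
      refine ⟨L₁.length + i, by omega, by simp, ?_⟩
      rw [hright _ (by omega) (by omega)]
      simpa using hs
  · intro e he f hf hef hs
    rw [decide_eq_decide] at hef
    by_cases hk : L₁.length ≤ e
    · have hk' := hef.1 hk
      rw [hright e (by omega) hk, hright f (by omega) hk'] at hs
      have := getElem_inj_of_isEdgeList h₂ _ _ hs
      omega
    · rw [hleft e (by omega), hleft f (by omega)] at hs
      exact getElem_inj_of_isEdgeList h₁ _ _ hs

/-- The three leading words and the two words for each edge have the positions that `Describes`
asks for. -/
theorem describes_inputWords {o : Fin n × Fin n} {F : Bool → SimpleGraph (Fin n)}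
    (h : Code n (L₁.length + L₂.length) L₁.length F
      (fun e => ((L₁ ++ L₂).getD e o).1) (fun e => ((L₁ ++ L₂).getD e o).2)) :
    Describes h.net L₁.length fun i => (inputWords L₁ L₂).getD i 0 := by
  intro e he
  have hlt : e < (L₁ ++ L₂).length := by rw [List.length_append]; exact he
  obtain ⟨h1, h2⟩ := getD_endpoints (L₁ ++ L₂) o hlt
  have hoff : (if e < L₁.length then 0 else n) = if decide (L₁.length ≤ e) then n else 0 := by
    by_cases hk : L₁.length ≤ e
    · simp [hk]
    · simp [hk, not_le.1 hk]
  change _ + (if e < L₁.length then 0 else n) = copy n _ _ ∧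
    _ + (if e < L₁.length then 0 else n) = copy n _ _
  rw [hoff, inputWords_eq, show 3 + 2 * e = 2 * e + 1 + 1 + 1 by ring,
    show 4 + 2 * e = 2 * e + 1 + 1 + 1 + 1 by ring]
  simp only [List.getD_cons_succ, copy, h1, h2, and_self]

/-- The program that decides whether the graph is a Laman graph. -/
def lamanProg : Prog := .seq (progOfInstrs preludeInstrs) (Cmd.seq buildCmd pruneCmd).compile

theorem lamanProg_exec {w : ℕ} (hcard : G.edgeSet.ncard + 3 = 2 * n)
    (hF : IsForestPartition G F₁ F₂) (h₁ : IsEdgeList F₁ L₁) (h₂ : IsEdgeList F₂ L₂)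
    (hw : 36 * n ≤ 2 ^ w) :
    ∃ s t, Exec w lamanProg (initial (inputWords L₁ L₂)) s t ∧ t ≤ 6100 * (n * Nat.log 2 n) ∧
      (s.reg 0 = 1 ↔ IsLaman G) ∧ (s.reg 0 = 0 ↔ ¬ IsLaman G) := by
  have hn : 2 ≤ n := by omega
  have h := code_of_isEdgeList (⟨0, by omega⟩, ⟨0, by omega⟩) hcard hF h₁ h₂
  have hlen : (inputWords L₁ L₂).length < 4 * n := by
    have := h.card
    rw [inputWords_eq]
    simp only [List.length_cons, length_endpoints, List.length_append]
    omega
  obtain ⟨s₀, hs₀, hrep⟩ := prelude_exec hn hlen (by rw [inputWords_eq]; rfl)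
    (by rw [inputWords_eq]; rfl) (by rw [inputWords_eq]; rfl) h.card hw
  have hsetup : Setup h.net (mkCtx n L₁.length (L₁.length + L₂.length) w hw) := by
    constructor <;> rfl
  have hwp := buildCmd_wp hsetup rfl (σ := { v := fun _ => 0, a := fun j i =>
      if j = .input then (inputWords L₁ L₂).getD i 0 else 0 })
    (describes_inputWords h) (fun _ => rfl)
    (fun j hj => by simp [hj])
  obtain ⟨s, t, σ, hexec, hrep', ⟨hyes, hno⟩, ht⟩ := Cmd.wp_seq (P := fun σ t =>
      ((σ.v .out = 1 ↔ ∀ Z, h.net.Supported Z → Z = ∅) ∧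
        (σ.v .out = 0 ↔ ¬ ∀ Z, h.net.Supported Z → Z = ∅)) ∧
      t ≤ 70 * n + 6000 * (n * Nat.log 2 n))
    (Cmd.wp_mono hwp fun σ₁ t₁ ⟨hr, ht₁⟩ => Cmd.wp_mono (pruneCmd_wp hsetup h.start hr)
      fun σ₂ t₂ ⟨h1, h2, ht₂⟩ => ⟨⟨h1, h2⟩, Nat.add_le_add ht₁ ht₂⟩) s₀ hrep
  have hlaman : (∀ Z, h.net.Supported Z → Z = ∅) ↔ IsLaman G := by
    rw [h.supported_iff, isLaman_iff hF (by simpa using hcard)]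
    rfl
  have hout : s.reg 0 = σ.v .out := hrep'.var .out
  refine ⟨s, 16 + t, .seq hs₀ hexec, ?_, by rw [hout, hyes, hlaman], by rw [hout, hno, hlaman]⟩
  have hlog : 1 ≤ Nat.log 2 n := Nat.log_pos one_lt_two hn
  have : n * 1 ≤ n * Nat.log 2 n := Nat.mul_le_mul_left n hlog
  omega

end Input
end LamanRAM

theorem theorem2 :
    ∃ (P : WordRAM.Prog) (c C : ℕ),
      ∀ (n : ℕ) (G F₁ F₂ : SimpleGraph (Fin n)) (L₁ L₂ : List (Fin n × Fin n)) (w : ℕ),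
        G.edgeSet.ncard + 3 = 2 * n →
        IsForestPartition G F₁ F₂ →
        IsEdgeList F₁ L₁ →
        IsEdgeList F₂ L₂ →
        c * Nat.log 2 n ≤ w →
        ∃ (s : WordRAM.State) (t : ℕ),
          WordRAM.Exec w P (WordRAM.initial (inputWords L₁ L₂)) s t ∧
          t ≤ C * (n * Nat.log 2 n) ∧
          (s.reg 0 = 1 ↔ IsLaman G) ∧
          (s.reg 0 = 0 ↔ ¬ IsLaman G) := by
  refine ⟨LamanRAM.lamanProg, 8, 6100, fun n G F₁ F₂ L₁ L₂ w hcard hF h₁ h₂ hw =>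
    LamanRAM.lamanProg_exec hcard hF h₁ h₂ ?_⟩
  -- `36 n ≤ 64 * 2 ^ (log n + 1) ≤ 2 ^ (8 log n)`, as `log n ≥ 1`.
  have hlog : 1 ≤ Nat.log 2 n := Nat.log_pos one_lt_two (by omega)
  have h1 : n < 2 ^ (Nat.log 2 n + 1) := Nat.lt_pow_succ_log_self one_lt_two n
  have h2 : 2 ^ (Nat.log 2 n + 1 + 6) ≤ 2 ^ w := Nat.pow_le_pow_right two_pos (by omega)
  rw [pow_add] at h2
  omega
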